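/- Let $k$ be a field and let $Q$ be a finite quiver without oriented cycles, with vertex set $V$. Let $\Lambda$ be its preprojective algebra over $k$, i.e. the path algebra of the double quiver (each arrow $a:i\to j$ gets a reverse arrow $a^*:j\to i$) modulo the relation $\sum_{a}(aa^*-a^*a)=0$. For $i\in V$ let $e_i\in\Lambda$ be the corresponding idempotent, $P_i=\Lambda e_i$, and $I_i=\Lambda(1-e_i)\Lambda$. Let $W_Q$ be the Coxeter group with generators $s_i$ $(i\in V)$, where for $i\neq j$ the order of $s_is_j$ is $2$, $3$ or $\infty$ according to whether the number of arrows between $i$ and $j$ is $0$, $1$ or at least $2$. For a reduced expression $\mathbf w=s_{i_1}\cdots s_{i_t}$ in $W_Q$ put $I_w=I_{i_1}\cdots I_{i_t}$, $\Lambda_w=\Lambda/I_w$, $$M_j=P_{i_j}/(I_{i_1}\cdots I_{i_j})P_{i_j}\quad(1\le j\le t),\qquad M_{\mathbf w}=M_1\oplus\cdots\oplus M_t,\qquad \Gamma_{\mathbf w}=\operatorname{End}_{\Lambda_w}(M_{\mathbf w}),$$ and let $\epsilon_j\in\Gamma_{\mathbf w}$ be the idempotent projecting onto $M_j$. (All modules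 are left modules and a product of endomorphisms is their composition.) A two-sided ideal $I$ of a ring $A$ is called heredity if $I^2=I$, $I$ is a projective left $A$-module, and $\operatorname{End}_A(I)$ is semisimple. A finite dimensional algebra $A$ is quasihereditary if it has a heredity chain, i.e. a chain of two-sided ideals $0=J_0\subseteq J_1\subseteq\cdots\subseteq J_n=A$ such that $J_{m+1}/J_m$ is a heredity ideal of $A/J_m$ for $0\le m<n$. **Theorem 2.1.** For every reduced expression $\mathbf w=s_{i_1}\cdots s_{i_t}$, the algebra $\Gamma=\Gamma_{\mathbf w}=\operatorname{End}_{\Lambda_w}(M_{\mathbf w})$ is (finite dimensional and) quasihereditary. More precisely: 1. The ideals $J_m$ of $\Gamma$ generated by $\epsilon_1,\dots,\epsilon_m$ $(0\le m\le t)$ form a heredity chain of $\Gamma$. 2. If $t\ge 1$, let $e=\epsilon_1$ and let $\mathbf w'=s_{i_2}\cdots s_{i_t}$. Then $M_1$ is a simple $\Lambda_w$-module, $\Gamma e\Gamma$ is a heredity ideal of $\Gamma$, and there is an isomorphism of $k$-algebras $\Gamma/\Gamma e\Gamma\cong\Gamma_{\mathbf w'}=\operatorname{End}_{\Lambda_{w'}}(M_{\mathbf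 w'})$ sending, for each $1\le j\le t-1$, the class of $\epsilon_{j+1}$ to the idempotent of $\Gamma_{\mathbf w'}$ projecting onto the $j$-th summand of $M_{\mathbf w'}$. Thus the chain in 1 arises by repeatedly factoring out the ideal generated by the idempotent of the first, simple, summand. -/

import Mathlib

/-! ### Quasihereditary algebras -/

section Quasihereditary

/-- The two-sided ideal `A S A` of a ring `A` generated by a set `S`. -/
def idealGen {A : Type*} [Ring A] (S : Set A) : Ideal A :=
  Ideal.span S * ⊤

instance idealGen_isTwoSided {A : Type*} [Ring A] (S : Set A) : (idealGen S).IsTwoSided :=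
  inferInstanceAs (Ideal.span S * ⊤).IsTwoSided

/-- A heredity ideal of `A`: a two-sided ideal `I` with `I ^ 2 = I` which is projective as a left
`A`-module and whose endomorphism ring as a left `A`-module is semisimple. -/
structure IsHeredityIdeal {A : Type*} [Ring A] (I : Ideal A) : Prop where
  isTwoSided : I.IsTwoSided
  mul_self : I * I = I
  projective : Module.Projective A I
  semisimple_end : IsSemisimpleRing (Module.End A I)

/-- `0 = I 0 ⊆ I 1 ⊆ ... ⊆ I n = A` is a heredity chain of `A`: each `I (m + 1) / I m` is a
heredity ideal of `A / I m`. (The terms `I m` with `m > n` play no role.) -/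
structure IsHeredityChain {A : Type*} [Ring A] (I : ℕ → Ideal A) [∀ m, (I m).IsTwoSided]
    (n : ℕ) : Prop where
  zero : I 0 = ⊥
  last : I n = ⊤
  le_succ : ∀ m < n, I m ≤ I (m + 1)
  heredity : ∀ m < n, IsHeredityIdeal ((I (m + 1)).map (Ideal.Quotient.mk (I m)))

/-- A quasihereditary algebra over `k`: a finite dimensional algebra with a heredity chain. -/
structure IsQuasihereditary (k A : Type*) [Field k] [Ring A] [Algebra k A] : Prop where
  finite : Module.Finite k A
  exists_chain : ∃ (n : ℕ) (I : ℕ → Ideal A) (_ : ∀ m, (I m).IsTwoSided), IsHeredityChain I n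

end Quasihereditary

/-! ### The preprojective algebra and the Coxeter group of a quiver -/

section Preprojective

universe u v w

/-- The quiver has no oriented cycles: every path from a vertex to itself is trivial. -/
def NoOrientedCycles (V : Type u) [Quiver.{v} V] : Prop :=
  ∀ (i : V) (p : Quiver.Path i i), p.length = 0

/-- The number of arrows (in either direction) between two vertices. -/
def numEdges {V : Type u} [Quiver.{v} V] [∀ i j : V, Fintype (i ⟶ j)] (i j : V) : ℕ :=
  Fintype.card (i ⟶ j) + Fintype.card (j ⟶ i)

theorem numEdges_comm {V : Type u} [Quiver.{v} V] [∀ i j : V, Fintype (i ⟶ j)] (i j : V) :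
    numEdges i j = numEdges j i :=
  add_comm _ _

/-- The Coxeter matrix of a quiver. Distinct generators `s_i`, `s_j` satisfy `(s_i s_j) ^ 2 = 1` if
`i` and `j` are not joined by an arrow, `(s_i s_j) ^ 3 = 1` if they are joined by exactly one arrow,
and no relation (encoded by the entry `0`) if they are joined by at least two arrows. -/
def quiverCoxeterMatrix (V : Type u) [DecidableEq V] [Quiver.{v} V]
    [∀ i j : V, Fintype (i ⟶ j)] : CoxeterMatrix V where
  M := Matrix.of fun i j =>
    if i = j then 1 else if numEdges i j = 0 then 2 else if numEdges i j = 1 then 3 else 0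
  isSymm := by
    ext i j
    simp only [Matrix.transpose_apply, Matrix.of_apply]
    by_cases h : i = j
    · subst h; rfl
    · simp only [h, Ne.symm h, if_false, numEdges_comm j i]
  diagonal i := by simp
  off_diagonal i j h := by
    simp only [Matrix.of_apply, h, if_false]
    split_ifs <;> simp

/-- `s_{i_1} ⋯ s_{i_t}` is a reduced expression in the Coxeter group of the quiver. -/
def IsReducedWord {V : Type u} [DecidableEq V] [Quiver.{v} V] [∀ i j : V, Fintype (i ⟶ j)]
    (ω : List V) : Prop :=
  (quiverCoxeterMatrix V).toCoxeterSystem.IsReduced ω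

/-- Generators of the path algebra of the double quiver: the trivial path at each vertex, and for
every arrow `a : i ⟶ j` the arrow `a` itself and a new arrow `a* : j ⟶ i`. -/
inductive DoubleGen (V : Type u) [Quiver.{v} V] : Type (max u v)
  | vertex (i : V) : DoubleGen V
  | arrow {i j : V} (a : i ⟶ j) : DoubleGen V
  | star {i j : V} (a : i ⟶ j) : DoubleGen V

variable (k : Type w) [Field k] {V : Type u} [Fintype V] [Quiver.{v} V]
  [∀ i j : V, Fintype (i ⟶ j)]

/-- The relations of the preprojective algebra. All but the last one present the path algebra of
the double quiver, in which a product `x * y` of arrows is "first `y`, then `x`": the trivial paths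
are orthogonal idempotents with sum `1`, and each arrow runs from its source to its target. The
last one is the preprojective relation `∑ a, (a a* - a* a) = 0`. -/
inductive PreprojRel : FreeAlgebra k (DoubleGen V) → FreeAlgebra k (DoubleGen V) → Prop
  | idem (i : V) :
      PreprojRel (.ι k (.vertex i) * .ι k (.vertex i)) (.ι k (.vertex i))
  | orth (i j : V) (h : i ≠ j) :
      PreprojRel (.ι k (.vertex i) * .ι k (.vertex j)) 0
  | sum_one :
      PreprojRel (∑ i : V, .ι k (.vertex i)) 1
  | arrow {i j : V} (a : i ⟶ j) :
      PreprojRel (.ι k (.vertex j) * .ι k (.arrow a) * .ι k (.vertex i)) (.ι k (.arrow a))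
  | star {i j : V} (a : i ⟶ j) :
      PreprojRel (.ι k (.vertex i) * .ι k (.star a) * .ι k (.vertex j)) (.ι k (.star a))
  | preproj :
      PreprojRel (∑ i : V, ∑ j : V, ∑ a : i ⟶ j,
        (.ι k (.arrow a) * .ι k (.star a) - .ι k (.star a) * .ι k (.arrow a))) 0

variable (V) in
/-- The preprojective algebra `Λ` of the quiver, over `k`. -/
def Preproj : Type _ := RingQuot (PreprojRel k (V := V))

noncomputable instance : Ring (Preproj k V) :=
  inferInstanceAs (Ring (RingQuot (PreprojRel k (V := V))))

noncomputable instance : Algebra k (Preproj k V) :=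
  inferInstanceAs (Algebra k (RingQuot (PreprojRel k (V := V))))

/-- The idempotent `e_i` of the preprojective algebra at the vertex `i`. -/
noncomputable def vertexIdem (i : V) : Preproj k V :=
  RingQuot.mkAlgHom k (PreprojRel k) (.ι k (.vertex i))

/-- The two-sided ideal `I_i = Λ (1 - e_i) Λ`. -/
noncomputable def vertexIdeal (i : V) : Ideal (Preproj k V) :=
  idealGen {1 - vertexIdem k i}

/-- The two-sided ideal `I_{i_1} ⋯ I_{i_t}` of a word; it is `Λ` for the empty word. -/
noncomputable def wordIdeal : List V → Ideal (Preproj k V)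
  | [] => ⊤
  | i :: ω => vertexIdeal k i * wordIdeal ω

instance wordIdeal_isTwoSided (ω : List V) : (wordIdeal k ω).IsTwoSided := by
  induction ω with
  | nil => exact inferInstanceAs (⊤ : Ideal (Preproj k V)).IsTwoSided
  | cons i ω ih => exact inferInstanceAs (vertexIdeal k i * wordIdeal k ω).IsTwoSided

theorem wordIdeal_le_take (ω : List V) (m : ℕ) : wordIdeal k ω ≤ wordIdeal k (ω.take m) := by
  induction ω generalizing m with
  | nil => simp
  | cons i ω ih =>
    cases m with
    | zero => exact le_top
    | succ m => exact Ideal.mul_mono_right (ih m)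

/-- The algebra `Λ_w = Λ / I_w`. -/
abbrev WordAlg (ω : List V) : Type _ := Preproj k V ⧸ wordIdeal k ω

/-- The indecomposable projective left module `P_i = Λ e_i`. -/
noncomputable abbrev vertexProj (i : V) : Ideal (Preproj k V) := Ideal.span {vertexIdem k i}

/-- The summand `M_j = P_{i_j} / (I_{i_1} ⋯ I_{i_j}) P_{i_j}` of the standard cluster tilting
object of the word `s_{i_1} ⋯ s_{i_t}` (positions in the word are counted from `0` here). -/
def StdSummand (ω : List V) (j : Fin ω.length) : Type _ :=
  vertexProj k ω[j] ⧸
    (wordIdeal k (ω.take (j + 1)) • (⊤ : Submodule (Preproj k V) (vertexProj k ω[j])))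

namespace StdSummand

variable (ω : List V) (j : Fin ω.length)

noncomputable instance : AddCommGroup (StdSummand k ω j) := by
  unfold StdSummand; infer_instance

noncomputable instance : Module (Preproj k V) (StdSummand k ω j) := by
  unfold StdSummand; infer_instance

noncomputable instance : Module k (StdSummand k ω j) := by
  unfold StdSummand; infer_instance

instance : IsScalarTower k (Preproj k V) (StdSummand k ω j) := by
  unfold StdSummand; infer_instance

theorem isTorsionBySet :
    Module.IsTorsionBySet (Preproj k V) (StdSummand k ω j) (wordIdeal k ω : Set (Preproj k V)) :=
  Module.isTorsionBySet_of_subset (wordIdeal_le_take k ω _)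
    (Module.isTorsionBySet_quotient_ideal_smul (vertexProj k ω[j])
      (wordIdeal k (ω.take (j + 1))))

/-- Since `I_w` annihilates `M_j`, it is a `Λ_w`-module. -/
noncomputable instance : Module (WordAlg k ω) (StdSummand k ω j) :=
  (isTorsionBySet k ω j).module

instance : IsScalarTower k (WordAlg k ω) (StdSummand k ω j) :=
  (isTorsionBySet k ω j).isScalarTower

end StdSummand

/-- The standard cluster tilting object `M = M_1 ⊕ ⋯ ⊕ M_t` of a word, as a left `Λ_w`-module. -/
abbrev StdObj (ω : List V) : Type _ := (j : Fin ω.length) → StdSummand k ω j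

/-- The endomorphism algebra `Γ = End_{Λ_w}(M)`. -/
abbrev StdEnd (ω : List V) : Type _ := Module.End (WordAlg k ω) (StdObj k ω)

/-- The idempotent of `Γ` corresponding to the summand `M_j` of `M`. -/
noncomputable def stdIdem (ω : List V) (j : Fin ω.length) : StdEnd k ω :=
  LinearMap.single (WordAlg k ω) (StdSummand k ω) j ∘ₗ LinearMap.proj j

/-- The ideal of `Γ` generated by the idempotents of the first `m` summands of `M`. -/
noncomputable def stdChain (ω : List V) (m : ℕ) : Ideal (StdEnd k ω) :=
  idealGen {x | ∃ j : Fin ω.length, (j : ℕ) < m ∧ x = stdIdem k ω j}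

instance stdChain_isTwoSided (ω : List V) (m : ℕ) : (stdChain k ω m).IsTwoSided :=
  inferInstanceAs (idealGen _).IsTwoSided

end Preprojective

/-! The proof removes the first letter `i` of a reduced word `i :: ω` and inducts. Its first summand
`M_1` is the simple module at `i`, with endomorphism ring `k`. Sending generators to generators, and
`M_1` to zero, gives a surjection `stdQuot` from `M` for `i :: ω` onto `M` for `ω`, whose kernel is
annihilated by `I_i`. The key fact is that the kernel contains every element annihilated by `I_i`
(`stdQuot_eq_zero_iff`). It is therefore stable under all endomorphisms, so these descend, and the
resulting map of endomorphism algebras is onto. An endomorphism in its kernel has values annihilated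
by `I_i`. It vanishes on `M_j` unless `i_j = i`, and in that case its restriction to `M_j` factors
through the canonical map from `M_j` to `M_1`. Hence the kernel is `Γ e Γ` with `e = ε_1`, and as a
left module it is a direct sum of copies of `Γ e`, one for each `j` with `i_j = i`. Since `e Γ e`
consists of scalars, this is a heredity ideal.

The key fact amounts to `Λ / I_w` having no socle at `i` whenever `s_i w` is longer than `w`
(`socleFree_wordIdeal`). It is proved by induction on length from the exactness of `e_i Λ → ⊕ e_h Λ
→ e_i Λ` (`exists_of_inMap_eq_zero`). The induction peels off left descents other than the first
letter of the given word, so `I_w` must depend on `w` alone (`wordIdeal_eq_of_wordProd_eq`). That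
follows from the braid relations between the `I_i`, once roots show that two left descents of one
element are joined by at most one arrow. -/

/-! ### Left descents and positive roots. -/

section CoxeterGeometry

variable {V : Type*} [DecidableEq V] [Quiver V] [∀ i j : V, Fintype (i ⟶ j)]

variable (V) in
/-- The Coxeter group of a quiver. -/
abbrev QuiverCoxeterGroup : Type _ := (quiverCoxeterMatrix V).Group

variable (V) in
/-- The Coxeter system of a quiver. -/
abbrev quiverCS : CoxeterSystem (quiverCoxeterMatrix V) (QuiverCoxeterGroup V) :=
  (quiverCoxeterMatrix V).toCoxeterSystem

theorem simple_mul_simple_comm {i j : V} (h : i ≠ j) (h0 : numEdges i j = 0) :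
    (quiverCS V).simple i * (quiverCS V).simple j =
      (quiverCS V).simple j * (quiverCS V).simple i := by
  have h1 := (quiverCS V).simple_mul_simple_pow i j
  have hM : (quiverCoxeterMatrix V) i j = 2 := by simp [quiverCoxeterMatrix, h, h0]
  rw [hM, pow_two] at h1
  have := eq_inv_of_mul_eq_one_left h1
  rwa [mul_inv_rev, CoxeterSystem.inv_simple, CoxeterSystem.inv_simple] at this

theorem simple_braid {i j : V} (h : i ≠ j) (h1 : numEdges i j = 1) :
    (quiverCS V).simple i * ((quiverCS V).simple j * (quiverCS V).simple i) =
      (quiverCS V).simple j * ((quiverCS V).simple i * (quiverCS V).simple j) := by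
  have h3 := (quiverCS V).simple_mul_simple_pow i j
  have hM : (quiverCoxeterMatrix V) i j = 3 := by simp [quiverCoxeterMatrix, h, h1]
  rw [hM, pow_succ, pow_two] at h3
  set s := (quiverCS V).simple
  have h4 : (s i * (s j * s i)) * (s j * (s i * s j)) = 1 := by simpa only [mul_assoc] using h3
  have := eq_inv_of_mul_eq_one_left h4
  simpa only [mul_inv_rev, s, CoxeterSystem.inv_simple, mul_assoc] using this

/-- If `s_i` and `s_j` commuted, `s_i s_j w = s_j s_i w` would have length at most that of `w`,
which is less than that of `s_j w`; so `i` would be a left descent of `s_j w`. -/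
theorem numEdges_ne_zero_of_isLeftDescent {w : QuiverCoxeterGroup V} {i j : V} (hij : i ≠ j)
    (hi : (quiverCS V).IsLeftDescent w i) (hj : ¬ (quiverCS V).IsLeftDescent w j)
    (hji : ¬ (quiverCS V).IsLeftDescent ((quiverCS V).simple j * w) i) : numEdges i j ≠ 0 := by
  intro h0
  apply hji
  rw [CoxeterSystem.isLeftDescent_iff, ← mul_assoc, simple_mul_simple_comm hij h0, mul_assoc,
    (quiverCS V).not_isLeftDescent_iff.1 hj]
  have h1 := (quiverCS V).isLeftDescent_iff.1 hi
  have h2 := (quiverCS V).length_mul_le ((quiverCS V).simple j) ((quiverCS V).simple i * w)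
  have h3 := (quiverCS V).length_mul_le ((quiverCS V).simple i) ((quiverCS V).simple j *
    ((quiverCS V).simple i * w))
  have h4 : (quiverCS V).simple i * ((quiverCS V).simple j * ((quiverCS V).simple i * w)) =
      (quiverCS V).simple j * w := by
    rw [← mul_assoc, simple_mul_simple_comm hij h0, mul_assoc,
      CoxeterSystem.simple_mul_simple_cancel_left]
  rw [h4, (quiverCS V).not_isLeftDescent_iff.1 hj] at h3
  simp only [CoxeterSystem.length_simple] at h2 h3
  omega

/-- Otherwise `w = s_i s_j z` with `z` two letters shorter, and the braid relation turns `s_i s_j w`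
into `s_j s_i z`, no longer than `w`. The hypotheses make it two letters longer than `w`. -/
theorem not_isLeftDescent_of_numEdges_eq_one {w : QuiverCoxeterGroup V} {i j : V} (hij : i ≠ j)
    (hi : (quiverCS V).IsLeftDescent w i) (hj : ¬ (quiverCS V).IsLeftDescent w j)
    (hji : ¬ (quiverCS V).IsLeftDescent ((quiverCS V).simple j * w) i) (h1 : numEdges i j = 1) :
    ¬ (quiverCS V).IsLeftDescent ((quiverCS V).simple i * w) j := by
  intro hd
  obtain ⟨z, hz⟩ : ∃ z, z = (quiverCS V).simple j * ((quiverCS V).simple i * w) := ⟨_, rfl⟩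
  have e1 := (quiverCS V).isLeftDescent_iff.1 hi
  have e2 := (quiverCS V).isLeftDescent_iff.1 hd
  have e3 := (quiverCS V).not_isLeftDescent_iff.1 hj
  have e4 := (quiverCS V).not_isLeftDescent_iff.1 hji
  have hw : w = (quiverCS V).simple i * ((quiverCS V).simple j * z) := by
    rw [hz, CoxeterSystem.simple_mul_simple_cancel_left,
      CoxeterSystem.simple_mul_simple_cancel_left]
  have h5 : (quiverCS V).simple i * ((quiverCS V).simple j * w) =
      (quiverCS V).simple j * ((quiverCS V).simple i * z) := by
    have h3 := simple_braid hij h1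
    rw [hw]
    simp only [← mul_assoc] at h3 ⊢
    rw [h3, mul_assoc _ _ z, mul_assoc _ _ z]
    simp only [mul_assoc, CoxeterSystem.simple_mul_simple_cancel_left]
  have l1 := (quiverCS V).length_mul_le ((quiverCS V).simple j) ((quiverCS V).simple i * z)
  have l2 := (quiverCS V).length_mul_le ((quiverCS V).simple i) z
  rw [← h5, e4, e3] at l1
  rw [← hz] at e2
  simp only [CoxeterSystem.length_simple] at l1 l2
  omega

variable [Fintype V]

/-- The symmetric generalized Cartan matrix of a quiver. -/
def quiverCartan (i j : V) : ℤ := if i = j then 2 else -(numEdges i j : ℤ)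

/-- The linear form `⟨α_i, -⟩` on the root lattice. -/
def cartanForm (i : V) : (V → ℤ) →ₗ[ℤ] ℤ := ∑ j, quiverCartan i j • LinearMap.proj j

/-- The simple reflection on the root lattice. -/
def simpleReflection (i : V) : Module.End ℤ (V → ℤ) :=
  LinearMap.id - (cartanForm i).smulRight (Pi.single i 1)

theorem cartanForm_single (i j : V) :
    cartanForm i (Pi.single j 1) = quiverCartan i j := by
  simp [cartanForm, LinearMap.sum_apply, Pi.single_apply]

theorem simpleReflection_apply (i : V) (v : V → ℤ) :
    simpleReflection i v = v - cartanForm i v • Pi.single i 1 := rfl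

theorem simpleReflection_isLiftable :
    (quiverCoxeterMatrix V).IsLiftable (simpleReflection (V := V)) := by
  intro i j
  have hc : ∀ i : V, quiverCartan i i = 2 := fun i => by simp [quiverCartan]
  by_cases h : i = j
  · subst h
    rw [CoxeterMatrix.diagonal, pow_one]
    refine LinearMap.ext fun v => ?_
    simp only [Module.End.mul_apply, simpleReflection_apply, map_sub, map_smul, cartanForm_single,
      hc, Module.End.one_apply]
    module
  · have hM : (quiverCoxeterMatrix V) i j =
        if numEdges i j = 0 then 2 else if numEdges i j = 1 then 3 else 0 := by
      simp [quiverCoxeterMatrix, h]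
    have hij : quiverCartan i j = -(numEdges i j : ℤ) := by simp [quiverCartan, h]
    have hji : quiverCartan j i = -(numEdges i j : ℤ) := by
      simp [quiverCartan, Ne.symm h, numEdges_comm j i]
    rw [hM]
    split_ifs with h0 h1
    · refine LinearMap.ext fun v => ?_
      simp only [pow_succ, pow_zero, one_mul, Module.End.mul_apply, simpleReflection_apply, map_sub,
        map_smul, cartanForm_single, hc, hij, hji, h0, Module.End.one_apply]
      module
    · refine LinearMap.ext fun v => ?_
      simp only [pow_succ, pow_zero, one_mul, Module.End.mul_apply, simpleReflection_apply, map_sub,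
        map_smul, cartanForm_single, hc, hij, hji, h1, Module.End.one_apply]
      push_cast
      module
    · simp

variable (V) in
/-- The geometric representation on the root lattice. -/
noncomputable def geomRep : QuiverCoxeterGroup V →* Module.End ℤ (V → ℤ) :=
  (quiverCS V).lift ⟨simpleReflection, simpleReflection_isLiftable⟩

theorem geomRep_simple (i : V) : geomRep V ((quiverCS V).simple i) = simpleReflection i :=
  (quiverCS V).lift_apply_simple simpleReflection_isLiftable i

/-- The root `w⁻¹ α_i`. -/
noncomputable def pulledRoot (w : QuiverCoxeterGroup V) (i : V) : V → ℤ :=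
  geomRep V w⁻¹ (Pi.single i 1)

theorem pulledRoot_one (i : V) : pulledRoot 1 i = Pi.single i 1 := by
  simp [pulledRoot]

theorem pulledRoot_simple_mul_self (w : QuiverCoxeterGroup V) (i : V) :
    pulledRoot ((quiverCS V).simple i * w) i = -pulledRoot w i := by
  have : simpleReflection i (Pi.single i 1) = -Pi.single i 1 := by
    rw [simpleReflection_apply, cartanForm_single]
    simp only [quiverCartan, if_true]
    module
  rw [pulledRoot, mul_inv_rev, map_mul, CoxeterSystem.inv_simple, geomRep_simple,
    Module.End.mul_apply, this, map_neg, pulledRoot]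

theorem pulledRoot_simple_mul (w : QuiverCoxeterGroup V) {i j : V} (h : i ≠ j) :
    pulledRoot ((quiverCS V).simple j * w) i =
      pulledRoot w i + (numEdges i j : ℤ) • pulledRoot w j := by
  have : simpleReflection j (Pi.single i 1) =
      Pi.single i 1 + (numEdges i j : ℤ) • Pi.single j 1 := by
    rw [simpleReflection_apply, cartanForm_single]
    simp only [quiverCartan, if_neg h.symm, numEdges_comm j i]
    module
  rw [pulledRoot, mul_inv_rev, map_mul, CoxeterSystem.inv_simple, geomRep_simple,
    Module.End.mul_apply, this, map_add, map_smul, pulledRoot, pulledRoot]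

theorem pulledRoot_ne_zero (w : QuiverCoxeterGroup V) (i : V) : pulledRoot w i ≠ 0 := by
  intro h
  have h2 := congrArg (geomRep V w) h
  rw [pulledRoot, ← Module.End.mul_apply, ← map_mul, mul_inv_cancel, map_one, map_zero,
    Module.End.one_apply] at h2
  simpa using congrFun h2 i

/-- If `s_i w` is longer than `w`, then `w⁻¹ α_i` is a positive root. -/
theorem pulledRoot_nonneg_aux (n : ℕ) : ∀ w : QuiverCoxeterGroup V, (quiverCS V).length w = n →
    ∀ i, ¬ (quiverCS V).IsLeftDescent w i → 0 ≤ pulledRoot w i ∧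
      ∀ j, 2 ≤ numEdges i j → i ≠ j → 0 ≤ pulledRoot w i + pulledRoot w j := by
  induction n using Nat.strong_induction_on with
  | _ n ih =>
  intro w hw
  set s := (quiverCS V).simple with hs
  have hpos : ∀ i, ¬ (quiverCS V).IsLeftDescent w i → 0 ≤ pulledRoot w i := by
    intro i hi
    by_cases h1 : w = 1
    · subst h1
      rw [pulledRoot_one]
      exact Pi.single_nonneg.2 zero_le_one
    obtain ⟨j, hj⟩ := (quiverCS V).exists_leftDescent_of_ne_one h1
    have hij : i ≠ j := fun h => hi (h ▸ hj)
    obtain ⟨x, hx⟩ : ∃ x, x = s j * w := ⟨_, rfl⟩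
    have hwx : w = s j * x := by rw [hx, hs, CoxeterSystem.simple_mul_simple_cancel_left]
    have hlx : (quiverCS V).length x + 1 = n := by
      rw [hx, ← hw]; exact (quiverCS V).isLeftDescent_iff.1 hj
    have hjx : ¬ (quiverCS V).IsLeftDescent x j := by
      rw [hx]; exact (quiverCS V).isLeftDescent_iff_not_isLeftDescent_mul.1 hj
    obtain ⟨px, px2⟩ := ih _ (by omega) x rfl j hjx
    rw [hwx, pulledRoot_simple_mul x hij]
    have key : 0 ≤ (numEdges i j : ℤ) • pulledRoot x j := smul_nonneg (by positivity) px
    -- If `i` is a left descent of `x`, then `x⁻¹ α_i` is negative and must be compensated. For a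
    -- single arrow the root equals `y⁻¹ α_j` with `y = s_i x`. For several arrows the second claim,
    -- applied to `x`, absorbs the negative term into one copy of `x⁻¹ α_j`.
    by_cases hix : (quiverCS V).IsLeftDescent x i
    · obtain ⟨y, hy⟩ : ∃ y, y = s i * x := ⟨_, rfl⟩
      have hxy : x = s i * y := by rw [hy, hs, CoxeterSystem.simple_mul_simple_cancel_left]
      have hly : (quiverCS V).length y + 1 = (quiverCS V).length x := by
        rw [hy]; exact (quiverCS V).isLeftDescent_iff.1 hix
      rw [hwx] at hi
      rcases Nat.lt_or_ge (numEdges i j) 2 with hn | hn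
      · have h0 := numEdges_ne_zero_of_isLeftDescent hij hix hjx hi
        have h1 : numEdges i j = 1 := by omega
        have hjy : ¬ (quiverCS V).IsLeftDescent y j :=
          hy ▸ not_isLeftDescent_of_numEdges_eq_one hij hix hjx hi h1
        have := (ih _ (by omega) y rfl j hjy).1
        rw [hxy, hs, pulledRoot_simple_mul_self, pulledRoot_simple_mul y hij.symm,
          numEdges_comm j i, h1]
        convert this using 1
        simp
      · have h4 := px2 i (by rwa [numEdges_comm]) hij.symm
        obtain ⟨c, hc⟩ := Nat.exists_eq_add_of_le hn
        have : pulledRoot x i + (numEdges i j : ℤ) • pulledRoot x j =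
            (pulledRoot x j + pulledRoot x i) + ((c + 1 : ℕ) : ℤ) • pulledRoot x j := by
          rw [hc]; push_cast; module
        rw [this]
        exact add_nonneg h4 (smul_nonneg (by positivity) px)
    · exact add_nonneg (ih _ (by omega) x rfl i hix).1 key
  intro i hi
  refine ⟨hpos i hi, fun j hn hij => ?_⟩
  by_cases hj : (quiverCS V).IsLeftDescent w j
  · obtain ⟨x, hx⟩ : ∃ x, x = s j * w := ⟨_, rfl⟩
    have hwx : w = s j * x := by rw [hx, hs, CoxeterSystem.simple_mul_simple_cancel_left]
    have hlx : (quiverCS V).length x + 1 = n := by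
      rw [hx, ← hw]; exact (quiverCS V).isLeftDescent_iff.1 hj
    have hjx : ¬ (quiverCS V).IsLeftDescent x j := by
      rw [hx]; exact (quiverCS V).isLeftDescent_iff_not_isLeftDescent_mul.1 hj
    obtain ⟨px, px2⟩ := ih _ (by omega) x rfl j hjx
    have h4 := px2 i (by rwa [numEdges_comm]) hij.symm
    obtain ⟨c, hc⟩ := Nat.exists_eq_add_of_le hn
    rw [hwx, pulledRoot_simple_mul x hij, hs, pulledRoot_simple_mul_self]
    have : pulledRoot x i + (numEdges i j : ℤ) • pulledRoot x j + -pulledRoot x j =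
        (pulledRoot x j + pulledRoot x i) + (c : ℤ) • pulledRoot x j := by
      rw [hc]; push_cast; module
    rw [this]
    exact add_nonneg h4 (smul_nonneg (by positivity) px)
  · exact add_nonneg (hpos i hi) (hpos j hj)

theorem pulledRoot_nonneg {w : QuiverCoxeterGroup V} {i : V}
    (hi : ¬ (quiverCS V).IsLeftDescent w i) : 0 ≤ pulledRoot w i :=
  (pulledRoot_nonneg_aux _ w rfl i hi).1

theorem isLeftDescent_of_pulledRoot_nonpos {w : QuiverCoxeterGroup V} {i : V}
    (h : pulledRoot w i ≤ 0) : (quiverCS V).IsLeftDescent w i := by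
  by_contra hi
  exact pulledRoot_ne_zero w i (le_antisymm h (pulledRoot_nonneg hi))

theorem pulledRoot_nonpos {w : QuiverCoxeterGroup V} {i : V}
    (hi : (quiverCS V).IsLeftDescent w i) : pulledRoot w i ≤ 0 := by
  have h := pulledRoot_nonneg ((quiverCS V).isLeftDescent_iff_not_isLeftDescent_mul.1 hi)
  rwa [pulledRoot_simple_mul_self, Left.nonneg_neg_iff] at h

/-- An infinite descent: `s_i` generates with `s_j` an infinite dihedral group, which has no longest
element. If both inequalities held for `w`, they would hold for the shorter `s_i w` with `i` and `j`
exchanged, down to the identity, which has no left descent. -/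
theorem not_pulledRoot_nonpos_of_two_le (n : ℕ) : ∀ (w : QuiverCoxeterGroup V),
    (quiverCS V).length w = n → ∀ i j : V, i ≠ j → 2 ≤ numEdges i j →
    pulledRoot w i ≤ 0 → ¬ pulledRoot w i + pulledRoot w j ≤ 0 := by
  induction n with
  | zero =>
    intro w hw i j _ _ hi _
    have := isLeftDescent_of_pulledRoot_nonpos hi
    rw [(quiverCS V).length_eq_zero_iff.1 hw] at this
    exact (quiverCS V).not_isLeftDescent_one i this
  | succ n ih =>
    intro w hw i j hij hn hi hs
    have hd := isLeftDescent_of_pulledRoot_nonpos hi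
    have hl := (quiverCS V).isLeftDescent_iff.1 hd
    obtain ⟨c, hc⟩ := Nat.exists_eq_add_of_le hn
    have hcn : (c : ℤ) • pulledRoot w i ≤ 0 := smul_nonpos_of_nonneg_of_nonpos (by positivity) hi
    have e1 : pulledRoot ((quiverCS V).simple i * w) j =
        (pulledRoot w i + pulledRoot w j) + ((c : ℤ) • pulledRoot w i + pulledRoot w i) := by
      rw [pulledRoot_simple_mul w hij.symm, numEdges_comm, hc]; push_cast; module
    refine ih ((quiverCS V).simple i * w) (by omega) j i hij.symm (by rwa [numEdges_comm]) ?_ ?_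
    · rw [e1]
      exact add_nonpos hs (add_nonpos hcn hi)
    · rw [e1, pulledRoot_simple_mul_self, ← sub_eq_add_neg, add_sub_assoc, add_sub_cancel_right]
      exact add_nonpos hs hcn

/-- Two distinct left descents are joined by at most one arrow. -/
theorem numEdges_lt_two_of_isLeftDescent {w : QuiverCoxeterGroup V} {i j : V} (hij : i ≠ j)
    (hi : (quiverCS V).IsLeftDescent w i) (hj : (quiverCS V).IsLeftDescent w j) :
    numEdges i j < 2 := by
  by_contra h
  exact not_pulledRoot_nonpos_of_two_le _ w rfl i j hij (not_lt.1 h) (pulledRoot_nonpos hi)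
    (add_nonpos (pulledRoot_nonpos hi) (pulledRoot_nonpos hj))

theorem isLeftDescent_simple_mul {w : QuiverCoxeterGroup V} {i j : V} (hij : i ≠ j)
    (hi : (quiverCS V).IsLeftDescent w i) (hj : (quiverCS V).IsLeftDescent w j) :
    (quiverCS V).IsLeftDescent ((quiverCS V).simple i * w) j := by
  apply isLeftDescent_of_pulledRoot_nonpos
  rw [pulledRoot_simple_mul w hij.symm]
  exact add_nonpos (pulledRoot_nonpos hj)
    (smul_nonpos_of_nonneg_of_nonpos (by positivity) (pulledRoot_nonpos hi))

/-- For a single edge `s_i s_j α_i = α_j`, so the root to be tested is `w⁻¹ α_j`. -/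
theorem isLeftDescent_simple_mul_simple_mul {w : QuiverCoxeterGroup V} {i j : V} (hij : i ≠ j)
    (h1 : numEdges i j = 1) (hj : (quiverCS V).IsLeftDescent w j) :
    (quiverCS V).IsLeftDescent ((quiverCS V).simple j * ((quiverCS V).simple i * w)) i := by
  apply isLeftDescent_of_pulledRoot_nonpos
  rw [pulledRoot_simple_mul _ hij, pulledRoot_simple_mul w hij.symm, pulledRoot_simple_mul_self,
    numEdges_comm j i, h1]
  convert pulledRoot_nonpos hj using 1
  simp

end CoxeterGeometry

/-! ### The preprojective relation as an exact sequence. -/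

section PreprojAlgebra

/-- The edges between two vertices, thought of as arrows of the double quiver from `h` to `i`. -/
abbrev QEdge {V : Type*} [Quiver V] (h i : V) : Type _ := (h ⟶ i) ⊕ (i ⟶ h)

theorem sum_edges {V : Type*} [Fintype V] [Quiver V] [∀ i j : V, Fintype (i ⟶ j)]
    {X : Type*} [AddCommMonoid X]
    (F : ∀ i h : V, QEdge h i → X) :
    ∑ i, ∑ h, ∑ a : QEdge h i, F i h a =
      ∑ i, ∑ j, ∑ a : i ⟶ j, (F j i (.inl a) + F i j (.inr a)) := by
  simp only [Fintype.sum_sum_type, Finset.sum_add_distrib]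
  rw [Finset.sum_comm]

variable (k : Type*) [Field k] {V : Type*} [Fintype V] [Quiver V] [∀ i j : V, Fintype (i ⟶ j)]

/-- The quotient map from the free algebra to the preprojective algebra. -/
noncomputable def preprojMk : FreeAlgebra k (DoubleGen V) →ₐ[k] Preproj k V :=
  RingQuot.mkAlgHom k (PreprojRel k)

theorem preprojMk_surjective : Function.Surjective (preprojMk k (V := V)) :=
  RingQuot.mkAlgHom_surjective k (PreprojRel k)

theorem preprojMk_rel {x y : FreeAlgebra k (DoubleGen V)} (h : PreprojRel k x y) :
    preprojMk k x = preprojMk k y :=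
  RingQuot.mkAlgHom_rel k h

/-- The universal property of the preprojective algebra. -/
noncomputable def preprojLift {B : Type*} [Semiring B] [Algebra k B] (f : DoubleGen V → B)
    (hf : ∀ ⦃x y⦄, PreprojRel k x y → FreeAlgebra.lift k f x = FreeAlgebra.lift k f y) :
    Preproj k V →ₐ[k] B :=
  RingQuot.liftAlgHom k ⟨FreeAlgebra.lift k f, hf⟩

theorem preprojLift_mk {B : Type*} [Semiring B] [Algebra k B] (f : DoubleGen V → B)
    (hf : ∀ ⦃x y⦄, PreprojRel k x y → FreeAlgebra.lift k f x = FreeAlgebra.lift k f y)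
    (g : DoubleGen V) : preprojLift k f hf (preprojMk k (.ι k g)) = f g := by
  refine (RingQuot.liftAlgHom_mkAlgHom_apply k (FreeAlgebra.lift k f) hf _).trans ?_
  simp

/-- The arrow of the double quiver from `h` to `i` given by an edge. -/
noncomputable def inArr {h i : V} : QEdge h i → Preproj k V :=
  Sum.elim (fun a => preprojMk k (.ι k (.arrow a))) (fun a => preprojMk k (.ι k (.star a)))

/-- The signed arrow of the double quiver from `i` to `h` given by an edge. -/
noncomputable def outArr {h i : V} : QEdge h i → Preproj k V :=
  Sum.elim (fun a => preprojMk k (.ι k (.star a))) (fun a => -preprojMk k (.ι k (.arrow a)))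

theorem vertexIdem_eq (i : V) : vertexIdem k i = preprojMk k (.ι k (.vertex i)) := rfl

@[simp] theorem vertexIdem_mul_self (i : V) : vertexIdem k i * vertexIdem k i = vertexIdem k i := by
  simpa [vertexIdem_eq] using preprojMk_rel k (.idem i)

theorem vertexIdem_mul_of_ne {i j : V} (h : i ≠ j) : vertexIdem k i * vertexIdem k j = 0 := by
  simpa [vertexIdem_eq] using preprojMk_rel k (.orth i j h)

theorem sum_vertexIdem : ∑ i : V, vertexIdem k i = 1 := by
  simpa [vertexIdem_eq] using preprojMk_rel k (.sum_one (V := V))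

theorem mul_inArr_mul {h i : V} (a : QEdge h i) :
    vertexIdem k i * inArr k a * vertexIdem k h = inArr k a := by
  rcases a with a | a
  · simpa [vertexIdem_eq, inArr] using preprojMk_rel k (.arrow a)
  · simpa [vertexIdem_eq, inArr] using preprojMk_rel k (.star a)

/-- Read from its other end, an edge has its two arrows exchanged. One sign remains, whose place
depends on the orientation of the edge in the quiver. -/
theorem inArr_swap {h i : V} (a : QEdge h i) :
    (inArr k a.swap = outArr k a ∧ outArr k a.swap = -inArr k a) ∨
    (inArr k a.swap = -outArr k a ∧ outArr k a.swap = inArr k a) := by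
  rcases a with a | a <;> simp [inArr, outArr]

@[simp] theorem vertexIdem_mul_inArr {h i : V} (a : QEdge h i) :
    vertexIdem k i * inArr k a = inArr k a := by
  rw [← mul_inArr_mul, ← mul_assoc, ← mul_assoc, vertexIdem_mul_self]

@[simp] theorem inArr_mul_vertexIdem {h i : V} (a : QEdge h i) :
    inArr k a * vertexIdem k h = inArr k a := by
  rw [← mul_inArr_mul, mul_assoc, vertexIdem_mul_self]

@[simp] theorem vertexIdem_mul_outArr {h i : V} (a : QEdge h i) :
    vertexIdem k h * outArr k a = outArr k a := by
  have := vertexIdem_mul_inArr k a.swap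
  rcases inArr_swap k a with h | h <;> simpa [h.1] using this

@[simp] theorem outArr_mul_vertexIdem {h i : V} (a : QEdge h i) :
    outArr k a * vertexIdem k i = outArr k a := by
  have := inArr_mul_vertexIdem k a.swap
  rcases inArr_swap k a with h | h <;> simpa [h.1] using this

theorem sum_inArr_mul_outArr_total :
    ∑ i : V, ∑ h, ∑ a : QEdge h i, inArr k a * outArr k a = 0 := by
  rw [sum_edges]
  simpa [inArr, outArr, sub_eq_add_neg] using preprojMk_rel k (.preproj (V := V))

/-- Left multiplication by `e_i` isolates the terms of the global relation ending at `i`; the sign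
built into `outArr` makes them a plain sum. -/
theorem sum_inArr_mul_outArr (i : V) :
    ∑ h, ∑ a : QEdge h i, inArr k a * outArr k a = 0 := by
  have h := congrArg (vertexIdem k i * ·) (sum_inArr_mul_outArr_total k (V := V))
  simp only [Finset.mul_sum, mul_zero, ← mul_assoc] at h
  rw [Finset.sum_eq_single i] at h
  · simpa using h
  · intro j _ hj
    refine Finset.sum_eq_zero fun h _ => Finset.sum_eq_zero fun a _ => ?_
    rw [← vertexIdem_mul_inArr, ← mul_assoc, vertexIdem_mul_of_ne k hj.symm, zero_mul, zero_mul]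
  · simp

/-- A subspace of the preprojective algebra which contains `1` and is stable under left
multiplication by the generators is everything. -/
theorem preproj_induction (S : Submodule k (Preproj k V)) (h1 : 1 ∈ S)
    (he : ∀ i, ∀ x ∈ S, vertexIdem k i * x ∈ S)
    (ha : ∀ (h i : V) (a : QEdge h i), ∀ x ∈ S, inArr k a * x ∈ S) (x : Preproj k V) : x ∈ S := by
  obtain ⟨y, rfl⟩ := preprojMk_surjective k x
  suffices ∀ x ∈ S, preprojMk k y * x ∈ S by simpa using this 1 h1
  induction y using FreeAlgebra.induction with
  | grade0 r => intro x hx; simpa [Algebra.algebraMap_eq_smul_one] using S.smul_mem r hx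
  | grade1 g =>
    cases g with
    | vertex i => exact he i
    | arrow a => exact ha _ _ (.inl a)
    | star a => exact ha _ _ (.inr a)
  | mul a b iha ihb => intro x hx; rw [map_mul, mul_assoc]; exact iha _ (ihb _ hx)
  | add a b iha ihb => intro x hx; rw [map_add, add_mul]; exact S.add_mem (iha _ hx) (ihb _ hx)

/-- The map `⊕ e_h Λ → e_i Λ` given by the arrows ending at `i`. -/
noncomputable def inMap (i : V) : (∀ h, QEdge h i → Preproj k V) →ₗ[k] Preproj k V where
  toFun y := ∑ h, ∑ a : QEdge h i, inArr k a * y h a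
  map_add' y z := by simp [mul_add, Finset.sum_add_distrib]
  map_smul' c y := by simp [Finset.smul_sum]

/-- The map `e_i Λ → ⊕ e_h Λ` given by the signed arrows starting at `i`. -/
noncomputable def outMap (i : V) : Preproj k V →ₗ[k] (∀ h, QEdge h i → Preproj k V) where
  toFun u h a := outArr k a * u
  map_add' y z := by ext; simp [mul_add]
  map_smul' c y := by ext; simp

theorem inMap_apply (i : V) (y : ∀ h, QEdge h i → Preproj k V) :
    inMap k i y = ∑ h, ∑ a : QEdge h i, inArr k a * y h a := rfl

theorem outMap_apply (i : V) (u : Preproj k V) {h : V} (a : QEdge h i) :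
    outMap k i u h a = outArr k a * u := rfl

theorem inMap_mul_right (i : V) (y : ∀ h, QEdge h i → Preproj k V) (x : Preproj k V) :
    inMap k i y * x = inMap k i fun h a => y h a * x := by
  simp only [inMap_apply, Finset.sum_mul, mul_assoc]

/-- The cokernel of `outMap`. -/
abbrev OutCoker (i : V) : Type _ :=
  (∀ h, QEdge h i → Preproj k V) ⧸ LinearMap.range (outMap k i)

open Classical in
/-- The class of an element in the slot of an arrow ending at `i`. -/
noncomputable def slot {h i : V} (a : QEdge h i) : Preproj k V →ₗ[k] ∀ i, OutCoker k (V := V) i :=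
  LinearMap.single k _ i ∘ₗ (Submodule.mkQ _) ∘ₗ LinearMap.single k _ h ∘ₗ
    LinearMap.single k (fun _ : QEdge h i => Preproj k V) a

theorem sum_slot_apply (y : ∀ i h, QEdge h i → Preproj k V) :
    ∑ i, ∑ h, ∑ a : QEdge h i, slot k a (y i h a) =
      fun i => Submodule.Quotient.mk (y i) := by
  classical
  have h1 : ∀ i h, ∑ a : QEdge h i, Pi.single (M := fun _ => Preproj k V) a (y i h a) = y i h :=
    fun i h => Finset.univ_sum_single _
  have h2 : ∀ i, ∑ h, Pi.single (M := fun h => QEdge h i → Preproj k V) h (y i h) = y i :=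
    fun i => Finset.univ_sum_single _
  have h3 : ∀ z : ∀ i, OutCoker k (V := V) i, ∑ i, Pi.single i (z i) = z :=
    fun z => Finset.univ_sum_single _
  simp only [slot, LinearMap.comp_apply, ← map_sum]
  simp only [LinearMap.coe_single, h1, h2]
  exact h3 _

open Classical in
/-- The action of the generators of `Λ` on `Λ × ∏ i, OutCoker i`. -/
noncomputable def slotGenAct : DoubleGen V →
    Module.End k (Preproj k V × ∀ i, OutCoker k (V := V) i)
  | .vertex i => (LinearMap.mulLeft k (vertexIdem k i)).prodMap
      (LinearMap.single k _ i ∘ₗ LinearMap.proj i)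
  | .arrow (i := i) a => ((LinearMap.mulLeft k (inArr k (.inl a))).prod
      (slot k (.inl a) ∘ₗ LinearMap.mulLeft k (vertexIdem k i))) ∘ₗ LinearMap.fst k _ _
  | .star (j := j) a => ((LinearMap.mulLeft k (inArr k (.inr a))).prod
      (slot k (.inr a) ∘ₗ LinearMap.mulLeft k (vertexIdem k j))) ∘ₗ LinearMap.fst k _ _

/-- The action is a form of Fox calculus: the second coordinate records which arrow was applied
last, and to what. The preprojective relation acts on that coordinate by the classes of `outMap k i
p.1`, and these vanish because the slots are taken modulo the range of `outMap`. -/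
theorem slotGenAct_rel ⦃x y : FreeAlgebra k (DoubleGen V)⦄ (hxy : PreprojRel k x y) :
    FreeAlgebra.lift k (slotGenAct k) x = FreeAlgebra.lift k (slotGenAct k) y := by
  classical
  cases hxy with
  | idem i =>
    refine LinearMap.ext fun p => ?_
    simp [slotGenAct, ← mul_assoc]
  | orth i j h =>
    refine LinearMap.ext fun p => ?_
    simp [slotGenAct, ← mul_assoc, vertexIdem_mul_of_ne k h, Pi.single_eq_of_ne h]
  | sum_one =>
    refine LinearMap.ext fun p => ?_
    have h3 : ∑ i, Pi.single (M := fun i => OutCoker k (V := V) i) i (p.2 i) = p.2 :=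
      Finset.univ_sum_single _
    refine Prod.ext ?_ ?_
    · simp [slotGenAct, LinearMap.sum_apply, Prod.fst_sum, ← Finset.sum_mul, sum_vertexIdem]
    · simpa [slotGenAct, LinearMap.sum_apply, Prod.snd_sum] using h3
  | arrow a =>
    refine LinearMap.ext fun p => Prod.ext ?_ ?_
    · simp [slotGenAct, ← mul_assoc]
    · simp [slotGenAct, ← mul_assoc, slot]
  | star a =>
    refine LinearMap.ext fun p => Prod.ext ?_ ?_
    · simp [slotGenAct, ← mul_assoc]
    · simp [slotGenAct, ← mul_assoc, slot]
  | preproj =>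
    refine LinearMap.ext fun p => ?_
    have key : ∀ (i j : V) (a : i ⟶ j), (slotGenAct k (.arrow a) * slotGenAct k (.star a) -
        slotGenAct k (.star a) * slotGenAct k (.arrow a)) p =
        (inArr k (.inl a : QEdge i j) * outArr k (.inl a : QEdge i j) * p.1 +
          inArr k (.inr a : QEdge j i) * outArr k (.inr a : QEdge j i) * p.1,
        slot k (.inl a : QEdge i j) (outArr k (.inl a : QEdge i j) * p.1) +
          slot k (.inr a : QEdge j i) (outArr k (.inr a : QEdge j i) * p.1)) := by
      intro i j a
      have e1 : vertexIdem k i * (inArr k (.inr a : QEdge j i) * p.1) =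
          outArr k (.inl a : QEdge i j) * p.1 := by
        rw [← mul_assoc, vertexIdem_mul_inArr]; rfl
      have e2 : vertexIdem k j * (inArr k (.inl a : QEdge i j) * p.1) =
          -(outArr k (.inr a : QEdge j i) * p.1) := by
        rw [← mul_assoc, vertexIdem_mul_inArr]; simp [inArr, outArr]
      refine Prod.ext ?_ ?_
      · change inArr k (.inl a : QEdge i j) * (inArr k (.inr a : QEdge j i) * p.1) -
          inArr k (.inr a : QEdge j i) * (inArr k (.inl a : QEdge i j) * p.1) = _
        simp [inArr, outArr, sub_eq_add_neg, mul_assoc]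
      · change slot k (.inl a : QEdge i j) (vertexIdem k i * (inArr k (.inr a : QEdge j i) * p.1)) -
          slot k (.inr a : QEdge j i) (vertexIdem k j * (inArr k (.inl a : QEdge i j) * p.1)) = _
        rw [e1, e2, map_neg, sub_neg_eq_add]
    simp only [map_sum, map_sub, map_mul, FreeAlgebra.lift_ι_apply, LinearMap.sum_apply, key,
      map_zero, LinearMap.zero_apply]
    refine Prod.ext ?_ ?_
    · have h := congrArg (· * p.1) (sum_inArr_mul_outArr_total k (V := V))
      simp only [Finset.sum_mul, zero_mul] at h
      rw [sum_edges fun i h (a : QEdge h i) => inArr k a * outArr k a * p.1] at h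
      simpa only [Prod.fst_sum, Prod.fst_zero] using h
    · have h := sum_slot_apply k (fun i h (a : QEdge h i) => outArr k a * p.1)
      have h0 : (fun i => (Submodule.Quotient.mk (fun h (a : QEdge h i) => outArr k a * p.1) :
          OutCoker k (V := V) i)) = 0 := by
        funext i
        exact (Submodule.Quotient.mk_eq_zero _).2 ⟨p.1, rfl⟩
      rw [h0, sum_edges fun i h (a : QEdge h i) => slot k a (outArr k a * p.1)] at h
      simpa only [Prod.snd_sum, Prod.snd_zero] using h

/-- The action of `Λ` on `Λ × ∏ i, OutCoker i`. -/
noncomputable def slotAct :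
    Preproj k V →ₐ[k] Module.End k (Preproj k V × ∀ i, OutCoker k (V := V) i) :=
  preprojLift k (slotGenAct k) (slotGenAct_rel k)

theorem slotAct_inArr {h i : V} (a : QEdge h i)
    (p : Preproj k V × ∀ i, OutCoker k (V := V) i) :
    slotAct k (inArr k a) p = (inArr k a * p.1, slot k a (vertexIdem k h * p.1)) := by
  rcases a with a | a
  · have : slotAct k (inArr k (.inl a : QEdge h i)) = _ := preprojLift_mk k _ (slotGenAct_rel k) _
    rw [this]; rfl
  · have : slotAct k (inArr k (.inr a : QEdge h i)) = _ := preprojLift_mk k _ (slotGenAct_rel k) _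
    rw [this]; rfl

theorem slotAct_apply_fst (x : Preproj k V) : (slotAct k x (1, 0)).1 = x := by
  refine preproj_induction k (LinearMap.ker ((LinearMap.fst k _ _ ∘ₗ
    LinearMap.applyₗ (1, 0) ∘ₗ (slotAct k).toLinearMap) - LinearMap.id)) ?_ ?_ ?_ x |> fun h => by
      simpa [sub_eq_zero] using h
  · simp
  · intro i x hx
    have : slotAct k (vertexIdem k i) = _ := preprojLift_mk k _ (slotGenAct_rel k) _
    simp only [LinearMap.mem_ker, LinearMap.sub_apply, LinearMap.comp_apply, sub_eq_zero,
      LinearMap.fst_apply, LinearMap.applyₗ_apply_apply, AlgHom.toLinearMap_apply,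
      LinearMap.id_apply] at hx ⊢
    rw [map_mul, this, Module.End.mul_apply]
    exact congrArg (vertexIdem k i * ·) hx
  · intro h i a x hx
    simp only [LinearMap.mem_ker, LinearMap.sub_apply, LinearMap.comp_apply, sub_eq_zero,
      LinearMap.fst_apply, LinearMap.applyₗ_apply_apply, AlgHom.toLinearMap_apply,
      LinearMap.id_apply] at hx ⊢
    rw [map_mul, Module.End.mul_apply, slotAct_inArr, hx]

/-- Exactness of `e_i Λ → ⊕ e_h Λ → e_i Λ`. -/
theorem exists_of_inMap_eq_zero {i : V} {y : ∀ h, QEdge h i → Preproj k V}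
    (hy : inMap k i y = 0) :
    ∃ u, ∀ (h : V) (a : QEdge h i), vertexIdem k h * y h a = outArr k a * u := by
  classical
  -- Acting on `(1, 0)`, the leftmost arrows of `inMap k i y` write the elements `vertexIdem k h * y
  -- h a` into their slots. The second coordinate is thus the class of this family in the cokernel
  -- at `i`, and its vanishing yields `u`.
  have h := congrArg (fun x => (slotAct k x (1, 0)).2) hy
  simp only [inMap_apply, map_sum, LinearMap.sum_apply, Prod.snd_sum, map_mul,
    Module.End.mul_apply, slotAct_inArr, slotAct_apply_fst, map_zero, LinearMap.zero_apply,
    Prod.snd_zero] at h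
  have h2 := sum_slot_apply k (Pi.single (M := fun i => ∀ h, QEdge h i → Preproj k V) i
    fun h a => vertexIdem k h * y h a)
  rw [Finset.sum_eq_single i] at h2
  · simp only [Pi.single_eq_same] at h2
    rw [h] at h2
    have h3 := (congrFun h2 i).symm
    simp only [Pi.single_eq_same, Pi.zero_apply, Submodule.Quotient.mk_eq_zero] at h3
    obtain ⟨u, hu⟩ := h3
    exact ⟨u, fun h a => (congrFun (congrFun hu h) a).symm⟩
  · intro j _ hj
    refine Finset.sum_eq_zero fun h _ => Finset.sum_eq_zero fun a _ => ?_
    rw [Pi.single_eq_of_ne hj]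
    exact map_zero _
  · simp

end PreprojAlgebra

/-! ### Products of the ideals `I_i`: braid relations and socles. -/

section WordIdeals

theorem ne_of_qEdge {V : Type*} [Quiver V] [hl : ∀ i : V, IsEmpty (i ⟶ i)] {h i : V}
    (a : QEdge h i) : h ≠ i := by
  rintro rfl
  exact a.elim (hl h).false (hl h).false

variable (k : Type*) [Field k] {V : Type*} [Fintype V] [Quiver V] [∀ i j : V, Fintype (i ⟶ j)]

theorem inMap_mem {i : V} {T : Ideal (Preproj k V)} {y : ∀ h, QEdge h i → Preproj k V}
    (hy : ∀ h (a : QEdge h i), inArr k a * y h a ∈ T) : inMap k i y ∈ T :=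
  T.sum_mem fun h _ => T.sum_mem fun a _ => hy h a

open Classical in
theorem inMap_single {h i : V} (a : QEdge h i) (x : Preproj k V) :
    inMap k i (Pi.single h (Pi.single a x)) = inArr k a * x := by
  rw [inMap_apply, Finset.sum_eq_single h, Finset.sum_eq_single a]
  · simp
  · intro b _ hb
    rw [Pi.single_eq_same, Pi.single_eq_of_ne hb, mul_zero]
  · simp
  · intro j _ hj
    rw [Pi.single_eq_of_ne hj]
    simp
  · simp

/-- Every element of `e_i Λ` is a multiple of `e_i` plus an element of the radical. -/
theorem exists_vertexIdem_mul_eq (i : V) (c : Preproj k V) :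
    ∃ (κ : k) (y : ∀ h, QEdge h i → Preproj k V),
      vertexIdem k i * c = κ • vertexIdem k i + inMap k i y := by
  classical
  suffices vertexIdem k i * c ∈ Submodule.span k {vertexIdem k i} ⊔ LinearMap.range (inMap k i) by
    obtain ⟨_, hp, _, ⟨y, rfl⟩, h⟩ := Submodule.mem_sup.1 this
    obtain ⟨κ, rfl⟩ := Submodule.mem_span_singleton.1 hp
    exact ⟨κ, y, h.symm⟩
  refine preproj_induction k (Submodule.comap (LinearMap.mulLeft k (vertexIdem k i))
    (Submodule.span k {vertexIdem k i} ⊔ LinearMap.range (inMap k i))) ?_ ?_ ?_ c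
  · simpa using Submodule.mem_sup_left (Submodule.mem_span_singleton_self _)
  · intro j x hx
    rw [Submodule.mem_comap, LinearMap.mulLeft_apply] at hx ⊢
    by_cases h : i = j
    · subst h
      rwa [← mul_assoc, vertexIdem_mul_self]
    · rw [← mul_assoc, vertexIdem_mul_of_ne k h, zero_mul]
      exact Submodule.zero_mem _
  · intro h j a x hx
    rw [Submodule.mem_comap, LinearMap.mulLeft_apply]
    by_cases hij : i = j
    · subst hij
      rw [← mul_assoc, vertexIdem_mul_inArr, ← inMap_single]
      exact Submodule.mem_sup_right ⟨_, rfl⟩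
    · rw [← vertexIdem_mul_inArr, ← mul_assoc, ← mul_assoc, vertexIdem_mul_of_ne k hij, zero_mul,
        zero_mul]
      exact Submodule.zero_mem _

instance vertexIdeal_isTwoSided (i : V) : (vertexIdeal k i).IsTwoSided :=
  inferInstanceAs (idealGen _).IsTwoSided

theorem one_sub_vertexIdem_mem (i : V) : 1 - vertexIdem k i ∈ vertexIdeal k i := by
  have := Submodule.smul_mem_smul (Ideal.subset_span (Set.mem_singleton (1 - vertexIdem k i)))
    (Submodule.mem_top : (1 : Preproj k V) ∈ (⊤ : Ideal (Preproj k V)))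
  simpa [vertexIdeal, idealGen] using this

/-- Right multiplication by `1 - e_i` kills the scalar part of `e_i c`, leaving only terms that
begin with an arrow into `i`. -/
theorem exists_inMap_of_mem_vertexIdeal {i : V} {r : Preproj k V} (hr : r ∈ vertexIdeal k i) :
    ∃ z, vertexIdem k i * r = inMap k i z := by
  suffices vertexIdem k i * r ∈ LinearMap.range (inMap k i) from
    let ⟨z, hz⟩ := this; ⟨z, hz.symm⟩
  refine Submodule.smul_induction_on hr ?_ ?_
  · intro p hp q _
    obtain ⟨c, rfl⟩ := Ideal.mem_span_singleton'.1 hp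
    obtain ⟨κ, y, h⟩ := exists_vertexIdem_mul_eq k i c
    have h0 : vertexIdem k i * (1 - vertexIdem k i) = 0 := by simp [mul_sub]
    rw [smul_eq_mul, ← mul_assoc, ← mul_assoc, h, add_mul, smul_mul_assoc, h0, smul_zero, zero_add,
      inMap_mul_right, inMap_mul_right]
    exact ⟨_, rfl⟩
  · intro x y hx hy
    rw [mul_add]
    exact Submodule.add_mem _ hx hy

theorem mem_of_vertexIdem_mul_mem {i j : V} {T : Ideal (Preproj k V)} [T.IsTwoSided]
    (hT : 1 - vertexIdem k i - vertexIdem k j ∈ T) {x : Preproj k V}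
    (hi : vertexIdem k i * x ∈ T) (hj : vertexIdem k j * x ∈ T) : x ∈ T := by
  have : x = (1 - vertexIdem k i - vertexIdem k j) * x + (vertexIdem k i * x + vertexIdem k j * x)
    := by noncomm_ring
  rw [this]
  exact T.add_mem (Ideal.mul_mem_right _ _ hT) (T.add_mem hi hj)

theorem one_sub_sub_comm (i j : V) :
    1 - vertexIdem k i - vertexIdem k j = 1 - vertexIdem k j - vertexIdem k i :=
  sub_right_comm _ _ _

theorem one_sub_sub_mem {i j : V} (hij : i ≠ j) :
    1 - vertexIdem k i - vertexIdem k j ∈ vertexIdeal k i := by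
  have h : (1 - vertexIdem k i) * (1 - vertexIdem k i - vertexIdem k j) =
      1 - vertexIdem k i - vertexIdem k j := by
    simp only [sub_mul, mul_sub, mul_one, one_mul, vertexIdem_mul_self,
      vertexIdem_mul_of_ne k hij]
    abel
  rw [← h]
  exact Ideal.mul_mem_right _ _ (one_sub_vertexIdem_mem k i)

theorem one_sub_sub_mem_mul {i j : V} (hij : i ≠ j) {I J : Ideal (Preproj k V)}
    (hI : 1 - vertexIdem k i - vertexIdem k j ∈ I) (hJ : 1 - vertexIdem k i - vertexIdem k j ∈ J) :
    1 - vertexIdem k i - vertexIdem k j ∈ I * J := by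
  have h : (1 - vertexIdem k i - vertexIdem k j) * (1 - vertexIdem k i - vertexIdem k j) =
      1 - vertexIdem k i - vertexIdem k j := by
    simp only [sub_mul, mul_sub, mul_one, one_mul, vertexIdem_mul_self,
      vertexIdem_mul_of_ne k hij, vertexIdem_mul_of_ne k hij.symm]
    abel
  rw [← h]
  exact Submodule.smul_mem_smul hI hJ

/-- No element of `Λ / I` spans a copy of the simple module at `i`. -/
def SocleFree (i : V) (I : Ideal (Preproj k V)) : Prop :=
  ∀ x, (∀ (h : V) (a : QEdge h i), outArr k a * x ∈ I) → vertexIdem k i * x ∈ I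

/-- A weakening of `SocleFree`: only elements for which one of the arrows from `i` to `j` lands in
the smaller ideal `I_j I` are considered. -/
def SocleFreeAt {i j : V} (b : QEdge j i) (I : Ideal (Preproj k V)) : Prop :=
  ∀ x, (∀ (h : V) (a : QEdge h i), outArr k a * x ∈ I) →
    outArr k b * x ∈ vertexIdeal k j * I → vertexIdem k i * x ∈ I

/-- A weakening of `SocleFree`: only elements for which all but one of the arrows from `i` to `j`
land in the smaller ideal `I_j I` are considered. -/
def SocleFreeOff {i j : V} (b : QEdge j i) (I : Ideal (Preproj k V)) : Prop :=
  ∀ x, (∀ (h : V) (a : QEdge h i), outArr k a * x ∈ I) →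
    (∀ c : QEdge j i, c ≠ b → outArr k c * x ∈ vertexIdeal k j * I) → vertexIdem k i * x ∈ I

variable {k} in
theorem SocleFree.off {i j : V} {I : Ideal (Preproj k V)} (h : SocleFree k i I) (b : QEdge j i) :
    SocleFreeOff k b I :=
  fun x hx _ => h x hx

variable {k} in
theorem SocleFreeAt.off {i j : V} {I : Ideal (Preproj k V)} {b c : QEdge j i}
    (h : SocleFreeAt k c I) (hcb : c ≠ b) : SocleFreeOff k b I :=
  fun x hx hc => h x hx (hc c hcb)

variable [hl : ∀ i : V, IsEmpty (i ⟶ i)]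

theorem inArr_mem {h i j : V} (a : QEdge h i) (hj : h ≠ j) {T : Ideal (Preproj k V)} [T.IsTwoSided]
    (hT : 1 - vertexIdem k i - vertexIdem k j ∈ T) : inArr k a ∈ T := by
  have h1 : inArr k a * (1 - vertexIdem k i - vertexIdem k j) * vertexIdem k h = inArr k a := by
    rw [mul_assoc, sub_mul, sub_mul, vertexIdem_mul_of_ne k (ne_of_qEdge a).symm,
      vertexIdem_mul_of_ne k hj.symm]
    simp
  rw [← h1]
  exact Ideal.mul_mem_right _ _ (T.mul_mem_left _ hT)

theorem inArr_mem_vertexIdeal {h i : V} (a : QEdge h i) : inArr k a ∈ vertexIdeal k i := by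
  have h1 : inArr k a * (1 - vertexIdem k i) * vertexIdem k h = inArr k a := by
    rw [mul_assoc, sub_mul, vertexIdem_mul_of_ne k (ne_of_qEdge a).symm]
    simp
  rw [← h1]
  exact Ideal.mul_mem_right _ _ (Ideal.mul_mem_left _ _ (one_sub_vertexIdem_mem k i))

/-- In the absence of loops the arrows into `i` lie in `I_i`, so `I_i` is the sum of `(1 - e_i) Λ`
and the right ideal generated by those arrows. Multiplying `I` by `I_i` therefore changes only the
part `e_i I`. -/
theorem mem_vertexIdeal_mul_iff {i : V} {I : Ideal (Preproj k V)} {x : Preproj k V} :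
    x ∈ vertexIdeal k i * I ↔
      x ∈ I ∧ ∃ y, (∀ h (a : QEdge h i), y h a ∈ I) ∧ vertexIdem k i * x = inMap k i y := by
  constructor
  · intro hx
    refine ⟨Ideal.mul_le_right hx, ?_⟩
    refine Submodule.smul_induction_on hx ?_ ?_
    · intro r hr s hs
      obtain ⟨z, hz⟩ := exists_inMap_of_mem_vertexIdeal k hr
      refine ⟨fun h a => z h a * s, fun h a => I.mul_mem_left _ hs, ?_⟩
      rw [smul_eq_mul, ← mul_assoc, hz, inMap_mul_right]
    · rintro x y ⟨p, hp, hxp⟩ ⟨q, hq, hyq⟩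
      exact ⟨p + q, fun h a => I.add_mem (hp h a) (hq h a), by rw [mul_add, hxp, hyq, map_add]⟩
  · rintro ⟨hx, y, hy, hxy⟩
    have : x = (1 - vertexIdem k i) * x + inMap k i y := by rw [← hxy]; noncomm_ring
    rw [this]
    refine Ideal.add_mem _ (Submodule.smul_mem_smul (one_sub_vertexIdem_mem k i) hx) ?_
    exact inMap_mem k fun h a => Submodule.smul_mem_smul (inArr_mem_vertexIdeal k a) (hy h a)

theorem mem_vertexIdeal_mul_of_eq_zero {i : V} {I : Ideal (Preproj k V)} {x : Preproj k V}
    (hx : x ∈ I) (h0 : vertexIdem k i * x = 0) : x ∈ vertexIdeal k i * I :=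
  (mem_vertexIdeal_mul_iff k).2 ⟨hx, 0, fun _ _ => I.zero_mem, by rw [h0, map_zero]⟩

section Braid

theorem vertexIdem_mul_mem_of_isEmpty {i j : V} (h0 : IsEmpty (QEdge j i))
    {T : Ideal (Preproj k V)} [T.IsTwoSided] (hT : 1 - vertexIdem k i - vertexIdem k j ∈ T)
    {x : Preproj k V} (hx : x ∈ vertexIdeal k i) : vertexIdem k i * x ∈ T := by
  obtain ⟨z, hz⟩ := exists_inMap_of_mem_vertexIdeal k hx
  rw [hz]
  refine inMap_mem k fun h a => Ideal.mul_mem_right _ _ (inArr_mem k a ?_ hT)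
  rintro rfl
  exact h0.false a

theorem vertexIdeal_mul_le_of_isEmpty {i j : V} (h0 : IsEmpty (QEdge j i))
    {T : Ideal (Preproj k V)} [T.IsTwoSided] (hT : 1 - vertexIdem k i - vertexIdem k j ∈ T) :
    vertexIdeal k i * vertexIdeal k j ≤ T := fun _ hx =>
  mem_of_vertexIdem_mul_mem k hT
    (vertexIdem_mul_mem_of_isEmpty k h0 hT (Ideal.mul_le_left hx))
    (vertexIdem_mul_mem_of_isEmpty k ⟨fun a => h0.false a.swap⟩ (one_sub_sub_comm k i j ▸ hT)
      (Ideal.mul_le_right hx))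

open Classical in
-- Modulo `T`, arrows into `i` or `j` from any third vertex vanish, so `e_j x` reduces to terms
-- starting with the length two path `j → i → j`. As there is at most one edge, the preprojective
-- relation at `j` says that this path is zero modulo `T`.
theorem vertexIdem_mul_mem_of_subsingleton {i j : V} (h1 : Subsingleton (QEdge i j))
    {T : Ideal (Preproj k V)} [T.IsTwoSided] (hT : 1 - vertexIdem k i - vertexIdem k j ∈ T)
    {x : Preproj k V} (hx : x ∈ vertexIdeal k j * vertexIdeal k i) : vertexIdem k j * x ∈ T := by
  have hT' : 1 - vertexIdem k j - vertexIdem k i ∈ T := one_sub_sub_comm k i j ▸ hT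
  obtain ⟨-, y, hy, hxy⟩ := (mem_vertexIdeal_mul_iff k).1 hx
  rw [hxy]
  refine inMap_mem k fun h b => ?_
  by_cases hh : h = i
  · subst hh
    obtain ⟨z, hz⟩ := exists_inMap_of_mem_vertexIdeal k (hy _ b)
    have hbb : inArr k b * inArr k b.swap ∈ T := by
      have hs := sum_inArr_mul_outArr k j
      rw [← Finset.add_sum_erase _ _ (Finset.mem_univ h)] at hs
      have hu : ∑ a : QEdge h j, inArr k a * outArr k a = inArr k b * outArr k b :=
        Finset.sum_eq_single b (fun c _ hc => (hc (h1.elim c b)).elim) (by simp)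
      rw [hu] at hs
      have : inArr k b * outArr k b ∈ T := by
        rw [eq_neg_of_add_eq_zero_left hs]
        refine T.neg_mem (T.sum_mem fun g hg => T.sum_mem fun a _ => ?_)
        exact Ideal.mul_mem_right _ _ (inArr_mem k a (Finset.ne_of_mem_erase hg) hT')
      rcases inArr_swap k b with hb | hb
      · rwa [hb.1]
      · rw [hb.1, mul_neg]
        exact T.neg_mem this
    rw [← inArr_mul_vertexIdem, mul_assoc, hz, inMap_apply, Finset.mul_sum]
    refine T.sum_mem fun g _ => ?_
    rw [Finset.mul_sum]
    refine T.sum_mem fun a _ => ?_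
    by_cases hg : g = j
    · subst hg
      have : a = b.swap := by
        rw [← h1.elim a.swap b, Sum.swap_swap]
      rw [this, ← mul_assoc]
      exact Ideal.mul_mem_right _ _ hbb
    · exact T.mul_mem_left _ (Ideal.mul_mem_right _ _ (inArr_mem k a hg hT))
  · exact Ideal.mul_mem_right _ _ (inArr_mem k b hh hT')

theorem vertexIdeal_mul_mul_le_of_subsingleton {i j : V} (h1 : Subsingleton (QEdge i j))
    {T : Ideal (Preproj k V)} [T.IsTwoSided] (hT : 1 - vertexIdem k i - vertexIdem k j ∈ T) :
    vertexIdeal k i * (vertexIdeal k j * vertexIdeal k i) ≤ T := by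
  intro x hx
  refine mem_of_vertexIdem_mul_mem k hT ?_
    (vertexIdem_mul_mem_of_subsingleton k h1 hT (Ideal.mul_le_right hx))
  obtain ⟨-, y, hy, hxy⟩ := (mem_vertexIdeal_mul_iff k).1 hx
  rw [hxy]
  refine inMap_mem k fun h b => ?_
  by_cases hh : h = j
  · subst hh
    rw [← inArr_mul_vertexIdem, mul_assoc]
    exact T.mul_mem_left _ (vertexIdem_mul_mem_of_subsingleton k h1 hT (hy _ b))
  · exact Ideal.mul_mem_right _ _ (inArr_mem k b hh hT)

theorem vertexIdeal_mul_comm_of_isEmpty {i j : V} (hij : i ≠ j) (h0 : IsEmpty (QEdge j i)) :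
    vertexIdeal k i * vertexIdeal k j = vertexIdeal k j * vertexIdeal k i := by
  have hi := one_sub_sub_mem k hij
  have hj : 1 - vertexIdem k i - vertexIdem k j ∈ vertexIdeal k j :=
    one_sub_sub_comm k j i ▸ one_sub_sub_mem k hij.symm
  refine le_antisymm (vertexIdeal_mul_le_of_isEmpty k h0 (one_sub_sub_mem_mul k hij hj hi))
    (vertexIdeal_mul_le_of_isEmpty k ⟨fun a => h0.false a.swap⟩ ?_)
  rw [one_sub_sub_comm]
  exact one_sub_sub_mem_mul k hij hi hj

/-- Each side is a two-sided ideal containing `1 - e_i - e_j`, so it can serve as `T` in the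
inclusion for the other side. -/
theorem vertexIdeal_braid {i j : V} (hij : i ≠ j) (h1 : Subsingleton (QEdge i j)) :
    vertexIdeal k i * (vertexIdeal k j * vertexIdeal k i) =
      vertexIdeal k j * (vertexIdeal k i * vertexIdeal k j) := by
  have hi := one_sub_sub_mem k hij
  have hj : 1 - vertexIdem k i - vertexIdem k j ∈ vertexIdeal k j :=
    one_sub_sub_comm k j i ▸ one_sub_sub_mem k hij.symm
  have h1' : Subsingleton (QEdge j i) := (Equiv.sumComm _ _).subsingleton
  refine le_antisymm (vertexIdeal_mul_mul_le_of_subsingleton k h1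
    (one_sub_sub_mem_mul k hij hj (one_sub_sub_mem_mul k hij hi hj)))
    (vertexIdeal_mul_mul_le_of_subsingleton k h1' ?_)
  rw [one_sub_sub_comm]
  exact one_sub_sub_mem_mul k hij hi (one_sub_sub_mem_mul k hij hj hi)

end Braid

section Socle

variable {k}

/-- The ideals `I` and `I_j I` have the same part at `i`, because `i ≠ j`. -/
theorem SocleFree.vertexIdeal_mul {i j : V} {I : Ideal (Preproj k V)} (h : SocleFree k i I)
    (hij : i ≠ j) : SocleFree k i (vertexIdeal k j * I) := fun x hx =>
  mem_vertexIdeal_mul_of_eq_zero k (h x fun g a => Ideal.mul_le_right (hx g a))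
    (by rw [← mul_assoc, vertexIdem_mul_of_ne k hij.symm, zero_mul])

theorem SocleFreeAt.vertexIdeal_mul {i j : V} {I : Ideal (Preproj k V)} {b : QEdge j i}
    (h : SocleFreeAt k b I) : SocleFree k i (vertexIdeal k j * I) := fun x hx =>
  mem_vertexIdeal_mul_of_eq_zero k (h x (fun g a => Ideal.mul_le_right (hx g a)) (hx j b))
    (by rw [← mul_assoc, vertexIdem_mul_of_ne k (ne_of_qEdge b), zero_mul])

/-- This is the inductive engine. A socle element `u` of `Λ / I_j I` at `j` whose image under `b`
lies in `I_i I_j I` gives a relation among the arrows into `i`. Exactness at `i` turns it into an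
element `z`, and the two hypotheses on `I` successively force `z` into `I` and `e_j u` into `I_j I`.
-/
theorem SocleFree.at_vertexIdeal_mul {i j : V} {I : Ideal (Preproj k V)} (h : SocleFree k j I)
    {b : QEdge i j} (hb : SocleFreeOff k b.swap I) : SocleFreeAt k b (vertexIdeal k j * I) := by
  classical
  intro u h1 h2
  set J := vertexIdeal k j * I with hJ
  obtain ⟨v, hv1, hv2⟩ : ∃ v, inArr k b.swap * v = outArr k b * u ∧ (v = u ∨ v = -u) := by
    rcases inArr_swap k b with hs | hs
    · exact ⟨u, by rw [hs.1], .inl rfl⟩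
    · exact ⟨-u, by rw [hs.1, neg_mul_neg], .inr rfl⟩
  have hvJ : ∀ (g : V) (a : QEdge g j), outArr k a * v ∈ J := by
    intro g a
    rcases hv2 with rfl | rfl
    · exact h1 g a
    · rw [mul_neg]; exact J.neg_mem (h1 g a)
  suffices hvj : vertexIdem k j * v ∈ J by
    rcases hv2 with rfl | rfl
    · exact hvj
    · rw [mul_neg] at hvj; exact J.neg_mem_iff.1 hvj
  obtain ⟨-, m, hm, hum⟩ := (mem_vertexIdeal_mul_iff k).1 h2
  rw [← mul_assoc, vertexIdem_mul_outArr, ← hv1, ← inMap_single] at hum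
  -- Both `m` and `v`, the latter placed in the slot of `b.swap`, map to `outArr k b * u`, so their
  -- difference comes from some `z`.
  obtain ⟨z, hz⟩ := exists_of_inMap_eq_zero k (y := m - Pi.single j (Pi.single b.swap v))
    (by rw [map_sub, hum, sub_self])
  have hzc : ∀ c : QEdge j i, c ≠ b.swap → outArr k c * z ∈ J := by
    intro c hc
    rw [← hz, Pi.sub_apply, Pi.sub_apply, Pi.single_eq_same, Pi.single_eq_of_ne hc, sub_zero]
    exact J.mul_mem_left _ (hm j c)
  have hzb : outArr k b.swap * z = vertexIdem k j * m j b.swap - vertexIdem k j * v := by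
    rw [← hz, Pi.sub_apply, Pi.sub_apply, Pi.single_eq_same, Pi.single_eq_same, mul_sub]
  -- Up to elements of `J`, `outArr k b.swap * z` is `-e_j v`, which every arrow leaving `j` sends
  -- into `J`; socle-freeness of `I` at `j` applies.
  have hzI : outArr k b.swap * z ∈ I := by
    have := h (outArr k b.swap * z) fun g a => by
      rw [hzb, mul_sub, ← mul_assoc, ← mul_assoc, outArr_mul_vertexIdem]
      exact Ideal.mul_le_right (J.sub_mem (J.mul_mem_left _ (hm _ _)) (hvJ g a))
    rwa [← mul_assoc, vertexIdem_mul_outArr] at this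
  have hez : vertexIdem k i * z ∈ I := by
    refine hb z (fun g a => ?_) hzc
    by_cases hg : g = j
    · subst hg
      by_cases ha : a = b.swap
      · exact ha ▸ hzI
      · exact Ideal.mul_le_right (hzc a ha)
    · rw [← hz, Pi.sub_apply, Pi.sub_apply, Pi.single_eq_of_ne hg, Pi.zero_apply, sub_zero]
      exact I.mul_mem_left _ (Ideal.mul_le_right (hm g a))
  -- Up to sign this is the arrow `inArr k b` into `j` applied to `e_i z ∈ I`, hence an element of
  -- `I_j I`.
  have hzJ : outArr k b.swap * z ∈ J := by
    rw [← outArr_mul_vertexIdem, mul_assoc]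
    have : inArr k b * (vertexIdem k i * z) ∈ J :=
      Submodule.smul_mem_smul (inArr_mem_vertexIdeal k b) hez
    rcases inArr_swap k b with hs | hs
    · rw [hs.2, neg_mul]; exact J.neg_mem this
    · rwa [hs.2]
  have : vertexIdem k j * v = vertexIdem k j * m j b.swap - outArr k b.swap * z := by
    rw [hzb, sub_sub_cancel]
  rw [this]
  exact J.sub_mem (J.mul_mem_left _ (hm _ _)) hzJ

end Socle

end WordIdeals

/-! ### The ideal `I_w` of a group element and the socle of `Λ / I_w`. -/

section ReducedWords

theorem numEdges_eq_card {V : Type*} [Quiver V] [∀ i j : V, Fintype (i ⟶ j)] (i j : V) :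
    numEdges i j = Fintype.card (QEdge i j) :=
  Fintype.card_sum.symm

variable {V : Type*} [DecidableEq V] [Quiver V] [∀ i j : V, Fintype (i ⟶ j)]

theorem isReducedWord_cons_iff {i : V} {ω : List V} :
    IsReducedWord (i :: ω) ↔
      IsReducedWord ω ∧ ¬ (quiverCS V).IsLeftDescent ((quiverCS V).wordProd ω) i := by
  constructor
  · intro h
    have hω : IsReducedWord ω := CoxeterSystem.IsReduced.drop h 1
    refine ⟨hω, ?_⟩
    rw [CoxeterSystem.not_isLeftDescent_iff, ← CoxeterSystem.wordProd_cons, hω.eq, h.eq,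
      List.length_cons]
  · rintro ⟨hω, hi⟩
    rw [CoxeterSystem.not_isLeftDescent_iff, ← CoxeterSystem.wordProd_cons, hω.eq] at hi
    exact hi

theorem exists_isReducedWord_cons {w : QuiverCoxeterGroup V} {i : V}
    (hi : (quiverCS V).IsLeftDescent w i) {ζ : List V} (hζ : IsReducedWord ζ)
    (h : (quiverCS V).wordProd ζ = (quiverCS V).simple i * w) :
    IsReducedWord (i :: ζ) ∧ (quiverCS V).wordProd (i :: ζ) = w := by
  refine ⟨isReducedWord_cons_iff.2 ⟨hζ, ?_⟩, ?_⟩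
  · rw [h]
    exact (quiverCS V).isLeftDescent_iff_not_isLeftDescent_mul.1 hi
  · rw [CoxeterSystem.wordProd_cons, h, CoxeterSystem.simple_mul_simple_cancel_left]

variable (k : Type*) [Field k] [Fintype V] [hl : ∀ i : V, IsEmpty (i ⟶ i)]

/-- The ideal of a reduced word only depends on the element of the Coxeter group. -/
theorem wordIdeal_eq_of_wordProd_eq (n : ℕ) : ∀ ω ω' : List V, ω.length = n → IsReducedWord ω →
    IsReducedWord ω' → (quiverCS V).wordProd ω = (quiverCS V).wordProd ω' →
    wordIdeal k ω = wordIdeal k ω' := by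
  induction n with
  | zero =>
    intro ω ω' hn h h' he
    have : ω'.length = 0 := by rw [← h'.eq, ← he, h.eq, hn]
    rw [List.length_eq_zero_iff.1 hn, List.length_eq_zero_iff.1 this]
  | succ n ih =>
    intro ω ω' hn h h' he
    have hn' : ω'.length = n + 1 := by rw [← h'.eq, ← he, h.eq, hn]
    obtain ⟨i, ω, rfl⟩ := List.exists_cons_of_length_eq_add_one hn
    obtain ⟨j, ω', rfl⟩ := List.exists_cons_of_length_eq_add_one hn'
    obtain ⟨hω, hi⟩ := isReducedWord_cons_iff.1 h
    obtain ⟨hω', hj⟩ := isReducedWord_cons_iff.1 h'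
    rw [List.length_cons, Nat.add_right_cancel_iff] at hn hn'
    set w := (quiverCS V).wordProd (i :: ω) with hw
    have hwi : (quiverCS V).wordProd ω = (quiverCS V).simple i * w := by
      rw [hw, CoxeterSystem.wordProd_cons, CoxeterSystem.simple_mul_simple_cancel_left]
    have hwj : (quiverCS V).wordProd ω' = (quiverCS V).simple j * w := by
      rw [he, CoxeterSystem.wordProd_cons, CoxeterSystem.simple_mul_simple_cancel_left]
    have di : (quiverCS V).IsLeftDescent w i := by
      rw [CoxeterSystem.isLeftDescent_iff_not_isLeftDescent_mul, ← hwi]; exact hi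
    have dj : (quiverCS V).IsLeftDescent w j := by
      rw [CoxeterSystem.isLeftDescent_iff_not_isLeftDescent_mul, ← hwj]; exact hj
    by_cases hij : i = j
    · subst hij
      change vertexIdeal k i * _ = vertexIdeal k i * _
      rw [ih ω ω' hn hω hω' (hwi.trans hwj.symm)]
    -- Matsumoto's argument: `w` has reduced words starting with `i j` and `j i` (no arrow), or with
    -- `i j i` and `j i j` (one arrow), with a common tail `ζ`. Induction moves `ω` and `ω'` to
    -- these words, and the relations between `I_i` and `I_j` compare them.
    have hlt := numEdges_lt_two_of_isLeftDescent hij di dj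
    have dij := isLeftDescent_simple_mul hij di dj
    have dji := isLeftDescent_simple_mul (Ne.symm hij) dj di
    change vertexIdeal k i * wordIdeal k ω = vertexIdeal k j * wordIdeal k ω'
    rcases (by omega : numEdges i j = 0 ∨ numEdges i j = 1) with h0 | h1
    · obtain ⟨ζ, hζ, hζe⟩ := (quiverCS V).exists_isReduced
        ((quiverCS V).simple j * ((quiverCS V).simple i * w))
      obtain ⟨r1, p1⟩ := exists_isReducedWord_cons dij hζ hζe.symm
      obtain ⟨r2, p2⟩ := exists_isReducedWord_cons dji hζ (by
        rw [← hζe, ← mul_assoc, ← mul_assoc, simple_mul_simple_comm hij h0])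
      rw [ih ω (j :: ζ) hn hω r1 (hwi.trans p1.symm), ih ω' (i :: ζ) hn' hω' r2 (hwj.trans p2.symm)]
      change vertexIdeal k i * (vertexIdeal k j * _) = vertexIdeal k j * (vertexIdeal k i * _)
      rw [← mul_assoc, ← mul_assoc, vertexIdeal_mul_comm_of_isEmpty k hij]
      rw [numEdges_comm, numEdges_eq_card] at h0
      exact Fintype.card_eq_zero_iff.1 h0
    · have diji := isLeftDescent_simple_mul_simple_mul hij h1 dj
      have djij := isLeftDescent_simple_mul_simple_mul (Ne.symm hij) (numEdges_comm i j ▸ h1) di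
      obtain ⟨ζ, hζ, hζe⟩ := (quiverCS V).exists_isReduced
        ((quiverCS V).simple i * ((quiverCS V).simple j * ((quiverCS V).simple i * w)))
      obtain ⟨r1, p1⟩ := exists_isReducedWord_cons diji hζ hζe.symm
      obtain ⟨r2, p2⟩ := exists_isReducedWord_cons dij r1 p1
      have hb := simple_braid hij h1
      obtain ⟨r3, p3⟩ := exists_isReducedWord_cons djij hζ (by
        rw [← hζe]
        simp only [← mul_assoc] at hb ⊢
        rw [hb])
      obtain ⟨r4, p4⟩ := exists_isReducedWord_cons dji r3 p3
      rw [ih ω _ hn hω r2 (hwi.trans p2.symm), ih ω' _ hn' hω' r4 (hwj.trans p4.symm)]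
      change vertexIdeal k i * (vertexIdeal k j * (vertexIdeal k i * _)) =
        vertexIdeal k j * (vertexIdeal k i * (vertexIdeal k j * _))
      have hs : Subsingleton (QEdge i j) := by
        rw [numEdges_eq_card] at h1
        exact Fintype.card_le_one_iff_subsingleton.1 h1.le
      have hI := vertexIdeal_braid k hij hs
      rw [← mul_assoc (vertexIdeal k j), ← mul_assoc (vertexIdeal k i), hI]
      simp only [mul_assoc]

/-- The ideal `I_w` of an element of the Coxeter group. -/
noncomputable def elemIdeal (w : QuiverCoxeterGroup V) : Ideal (Preproj k V) :=
  wordIdeal k ((quiverCS V).exists_isReduced w).choose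

theorem elemIdeal_wordProd {ω : List V} (hω : IsReducedWord ω) :
    elemIdeal k ((quiverCS V).wordProd ω) = wordIdeal k ω :=
  have h := ((quiverCS V).exists_isReduced ((quiverCS V).wordProd ω)).choose_spec
  wordIdeal_eq_of_wordProd_eq k _ _ _ rfl h.1 hω h.2.symm

theorem elemIdeal_one : elemIdeal k (1 : QuiverCoxeterGroup V) = ⊤ := by
  have h : IsReducedWord ([] : List V) := by simp [IsReducedWord, CoxeterSystem.IsReduced]
  have := elemIdeal_wordProd k h
  rwa [CoxeterSystem.wordProd_nil] at this

/-- Independence of the word allows any left descent to be split off, not only the first letter of a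
chosen word. -/
theorem elemIdeal_of_isLeftDescent {w : QuiverCoxeterGroup V} {i : V}
    (hi : (quiverCS V).IsLeftDescent w i) :
    elemIdeal k w = vertexIdeal k i * elemIdeal k ((quiverCS V).simple i * w) := by
  obtain ⟨ζ, hζ, hζe⟩ := (quiverCS V).exists_isReduced ((quiverCS V).simple i * w)
  obtain ⟨r, p⟩ := exists_isReducedWord_cons hi hζ hζe.symm
  rw [hζe, elemIdeal_wordProd k hζ, ← p, elemIdeal_wordProd k r, wordIdeal]

/-- The induction runs parallel to the positivity of roots. Write `w = s_j x` for a left descent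
`j`. If `i` is a left descent of `x` too, `I_w = I_j I_i I_y` and `SocleFree.at_vertexIdeal_mul`
applies over `I_y`. Its second hypothesis comes from `j` not being a left descent of `y` (one arrow)
or from the second claim (several arrows). The second claim itself needs a further edge `c ≠ b` when
`i` is a left descent. -/
theorem socleFree_elemIdeal_aux (n : ℕ) : ∀ w : QuiverCoxeterGroup V, (quiverCS V).length w = n →
    (∀ i, ¬ (quiverCS V).IsLeftDescent w i → SocleFree k i (elemIdeal k w)) ∧
    ∀ i j (b : QEdge j i), 2 ≤ numEdges i j → SocleFreeOff k b (elemIdeal k w) := by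
  induction n using Nat.strong_induction_on with
  | _ n ih =>
  intro w hw
  have hlt : ∀ {x : QuiverCoxeterGroup V} {i}, (quiverCS V).IsLeftDescent x i →
      (quiverCS V).length ((quiverCS V).simple i * x) < (quiverCS V).length x := fun h => h
  have hself : ∀ {x : QuiverCoxeterGroup V} {i}, (quiverCS V).IsLeftDescent x i →
      ¬ (quiverCS V).IsLeftDescent ((quiverCS V).simple i * x) i :=
    fun h => (quiverCS V).isLeftDescent_iff_not_isLeftDescent_mul.1 h
  have hfree : ∀ i, ¬ (quiverCS V).IsLeftDescent w i → SocleFree k i (elemIdeal k w) := by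
    intro i hi
    by_cases h1 : w = 1
    · rw [h1, elemIdeal_one]
      exact fun _ _ => Submodule.mem_top
    obtain ⟨j, hj⟩ := (quiverCS V).exists_leftDescent_of_ne_one h1
    have hij : i ≠ j := fun h => hi (h ▸ hj)
    have hx := hw ▸ hlt hj
    rw [elemIdeal_of_isLeftDescent k hj]
    set x := (quiverCS V).simple j * w with hxw
    have hwx : w = (quiverCS V).simple j * x := by
      rw [hxw, CoxeterSystem.simple_mul_simple_cancel_left]
    by_cases hix : (quiverCS V).IsLeftDescent x i
    · have hy := (hlt hix).trans hx
      rw [hwx] at hi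
      have h0 := numEdges_ne_zero_of_isLeftDescent hij hix (hself hj) hi
      obtain ⟨b⟩ : Nonempty (QEdge j i) := by
        rw [← Fintype.card_pos_iff, ← numEdges_eq_card, numEdges_comm]
        exact Nat.pos_of_ne_zero h0
      refine SocleFreeAt.vertexIdeal_mul (b := b) ?_
      rw [elemIdeal_of_isLeftDescent k hix]
      refine SocleFree.at_vertexIdeal_mul ((ih _ hy _ rfl).1 i (hself hix)) ?_
      rcases Nat.lt_or_ge (numEdges i j) 2 with hn | hn
      · exact ((ih _ hy _ rfl).1 j
          (not_isLeftDescent_of_numEdges_eq_one hij hix (hself hj) hi (by omega))).off _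
      · exact (ih _ hy _ rfl).2 j i b.swap (numEdges_comm i j ▸ hn)
    · exact ((ih _ hx _ rfl).1 i hix).vertexIdeal_mul hij
  refine ⟨hfree, fun i j b hn => ?_⟩
  by_cases hi : (quiverCS V).IsLeftDescent w i
  · obtain ⟨c, hc⟩ : ∃ c, c ≠ b := by
      have : 1 < Fintype.card (QEdge j i) := by rwa [← numEdges_eq_card, numEdges_comm]
      have := Fintype.one_lt_card_iff_nontrivial.1 this
      exact exists_ne b
    have hx := hw ▸ hlt hi
    refine SocleFreeAt.off ?_ hc
    rw [elemIdeal_of_isLeftDescent k hi]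
    exact SocleFree.at_vertexIdeal_mul ((ih _ hx _ rfl).1 i (hself hi))
      ((ih _ hx _ rfl).2 j i c.swap (numEdges_comm i j ▸ hn))
  · exact (hfree i hi).off b

/-- If `s_i w` is longer than `w`, then `Λ / I_w` has no simple submodule at `i`. -/
theorem socleFree_wordIdeal {i : V} {ω : List V} (h : IsReducedWord (i :: ω)) :
    SocleFree k i (wordIdeal k ω) := by
  obtain ⟨hω, hi⟩ := isReducedWord_cons_iff.1 h
  rw [← elemIdeal_wordProd k hω]
  exact (socleFree_elemIdeal_aux k _ _ rfl).1 i hi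

end ReducedWords

/-! ### Generators and relations for the summands of `M`. -/

section Summands

variable (k : Type*) [Field k] {V : Type*} [Fintype V] [Quiver V] [∀ i j : V, Fintype (i ⟶ j)]

namespace StdSummand

variable (ω : List V) (j : Fin ω.length)

/-- The surjection `Λ → M_j`, `x ↦ x e_{i_j}`. -/
noncomputable def proj : Preproj k V →ₗ[Preproj k V] StdSummand k ω j where
  toFun x := Submodule.Quotient.mk (p := wordIdeal k (ω.take (j + 1)) •
    (⊤ : Submodule (Preproj k V) (vertexProj k ω[j])))
    ⟨x * vertexIdem k ω[j], Ideal.mem_span_singleton'.2 ⟨x, rfl⟩⟩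
  map_add' x y := congrArg (Submodule.Quotient.mk (p := wordIdeal k (ω.take (j + 1)) •
    (⊤ : Submodule (Preproj k V) (vertexProj k ω[j])))) (Subtype.ext (add_mul _ _ _))
  map_smul' c x := congrArg (Submodule.Quotient.mk (p := wordIdeal k (ω.take (j + 1)) •
    (⊤ : Submodule (Preproj k V) (vertexProj k ω[j])))) (Subtype.ext (mul_assoc _ _ _))

theorem proj_surjective : Function.Surjective (proj k ω j) := by
  intro m
  obtain ⟨⟨x, hx⟩, rfl⟩ := Submodule.Quotient.mk_surjective (wordIdeal k (ω.take (j + 1)) •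
    (⊤ : Submodule (Preproj k V) (vertexProj k ω[j]))) m
  obtain ⟨y, rfl⟩ := Ideal.mem_span_singleton'.1 hx
  exact ⟨y, rfl⟩

variable {ω j}

/-- For a two-sided ideal `I` and an idempotent `e`, `I · Λ e = I ∩ Λ e`. -/
theorem proj_eq_zero_iff {x : Preproj k V} :
    proj k ω j x = 0 ↔ x * vertexIdem k ω[j] ∈ wordIdeal k (ω.take (j + 1)) := by
  refine (Submodule.Quotient.mk_eq_zero (wordIdeal k (ω.take (j + 1)) •
    (⊤ : Submodule (Preproj k V) (vertexProj k ω[j])))).trans ⟨fun h => ?_, fun h => ?_⟩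
  · have : ∀ y : vertexProj k ω[j], y ∈ wordIdeal k (ω.take (j + 1)) •
        (⊤ : Submodule (Preproj k V) (vertexProj k ω[j])) →
        (y : Preproj k V) ∈ wordIdeal k (ω.take (j + 1)) := by
      intro y hy
      refine Submodule.smul_induction_on hy ?_ ?_
      · intro r hr n _
        exact Ideal.mul_mem_right _ _ hr
      · intro x y hx hy
        exact Ideal.add_mem _ hx hy
    exact this _ h
  · have := Submodule.smul_mem_smul h (Submodule.mem_top :
      (⟨vertexIdem k ω[j], Ideal.mem_span_singleton_self _⟩ : vertexProj k ω[j]) ∈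
        (⊤ : Submodule (Preproj k V) (vertexProj k ω[j])))
    convert this using 1
    exact Subtype.ext (by simp [mul_assoc])

theorem proj_mul_vertexIdem (x : Preproj k V) : proj k ω j (x * vertexIdem k ω[j]) = proj k ω j x :=
  congrArg (Submodule.Quotient.mk (p := wordIdeal k (ω.take (j + 1)) •
    (⊤ : Submodule (Preproj k V) (vertexProj k ω[j])))) (Subtype.ext (by simp [mul_assoc]))

theorem exists_smul_proj_one (m : StdSummand k ω j) : ∃ x : Preproj k V, m = x • proj k ω j 1 := by
  obtain ⟨x, rfl⟩ := proj_surjective k ω j m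
  exact ⟨x, by rw [← map_smul, smul_eq_mul, mul_one]⟩

theorem vertexIdem_smul_proj_one : vertexIdem k ω[j] • proj k ω j 1 = proj k ω j 1 := by
  rw [← map_smul, smul_eq_mul, mul_one, ← one_mul (vertexIdem k ω[j]), proj_mul_vertexIdem]

/-- Homomorphisms out of `M_j` are given by the images of the canonical generator. -/
theorem exists_lift {N : Type*} [AddCommGroup N] [Module (Preproj k V) N] (n : N)
    (hn : ∀ x, x * vertexIdem k ω[j] ∈ wordIdeal k (ω.take (j + 1)) → x • n = 0) :
    ∃ f : StdSummand k ω j →ₗ[Preproj k V] N, f (proj k ω j 1) = n := by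
  have hle : LinearMap.ker (proj k ω j) ≤ LinearMap.ker (LinearMap.toSpanSingleton _ _ n) :=
    fun x hx => hn x ((proj_eq_zero_iff k).1 hx)
  refine ⟨(LinearMap.ker (proj k ω j)).liftQ (LinearMap.toSpanSingleton _ _ n) hle ∘ₗ
    ((proj k ω j).quotKerEquivOfSurjective (proj_surjective k ω j)).symm.toLinearMap, ?_⟩
  have : ((proj k ω j).quotKerEquivOfSurjective (proj_surjective k ω j)).symm (proj k ω j 1) =
      Submodule.Quotient.mk 1 := by
    rw [LinearEquiv.symm_apply_eq]
    rfl
  rw [LinearMap.comp_apply, LinearEquiv.coe_coe, this]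
  simp

end StdSummand

variable (ω : List V)

/-- A `Λ`-linear endomorphism of `M` is `Λ_w`-linear. -/
noncomputable def stdEndOfLinear (f : StdObj k ω →ₗ[Preproj k V] StdObj k ω) : StdEnd k ω where
  toFun := f
  map_add' := map_add f
  map_smul' r m := by
    obtain ⟨r, rfl⟩ := Ideal.Quotient.mk_surjective r
    exact f.map_smul r m

variable {ω}

theorem stdEnd_map_smul (f : StdEnd k ω) (r : Preproj k V) (m : StdObj k ω) :
    f (r • m) = r • f m :=
  f.map_smul (Ideal.Quotient.mk (wordIdeal k ω) r) m

theorem stdObj_smul_algebraMap (c : k) (m : StdObj k ω) :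
    algebraMap k (Preproj k V) c • m = c • m := by
  rw [algebraMap_smul]

/-- The canonical generator of the `j`-th summand of `M`. -/
noncomputable def stdGen (j : Fin ω.length) : StdObj k ω := Pi.single j (StdSummand.proj k ω j 1)

theorem vertexIdem_smul_stdGen (j : Fin ω.length) :
    vertexIdem k ω[j] • stdGen k j = stdGen k j := by
  rw [stdGen, ← Pi.single_smul, StdSummand.vertexIdem_smul_proj_one]

theorem smul_stdGen_eq_zero {j : Fin ω.length} {x : Preproj k V}
    (hx : x ∈ wordIdeal k (ω.take (j + 1))) : x • stdGen k j = 0 := by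
  rw [stdGen, ← Pi.single_smul, ← map_smul, smul_eq_mul, mul_one,
    (StdSummand.proj_eq_zero_iff k).2 (Ideal.mul_mem_right _ _ hx), Pi.single_zero]

theorem stdEnd_ext {f g : StdEnd k ω} (h : ∀ j, f (stdGen k j) = g (stdGen k j)) : f = g := by
  refine LinearMap.pi_ext fun j x => ?_
  obtain ⟨r, rfl⟩ := StdSummand.exists_smul_proj_one k x
  rw [Pi.single_smul]
  exact (stdEnd_map_smul k f r _).trans ((congrArg (r • ·) (h j)).trans
    (stdEnd_map_smul k g r _).symm)

/-- An endomorphism of `M` is given by the images of the generators. -/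
theorem exists_stdEnd (n : Fin ω.length → StdObj k ω)
    (hn : ∀ (j : Fin ω.length) (x : Preproj k V),
      x * vertexIdem k ω[j] ∈ wordIdeal k (ω.take (j + 1)) → x • n j = 0) :
    ∃ f : StdEnd k ω, ∀ j, f (stdGen k j) = n j := by
  choose f hf using fun j => StdSummand.exists_lift k (n j) (hn j)
  refine ⟨stdEndOfLinear k ω (∑ j, f j ∘ₗ LinearMap.proj j), fun j => ?_⟩
  change (∑ j, f j ∘ₗ LinearMap.proj j) (stdGen k j) = _
  rw [LinearMap.sum_apply, Finset.sum_eq_single j]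
  · simp [stdGen, hf]
  · intro l _ hl
    simp [stdGen, Pi.single_eq_of_ne hl]
  · simp

theorem stdIdem_apply (j : Fin ω.length) (m : StdObj k ω) : stdIdem k ω j m = Pi.single j (m j) :=
  rfl

theorem stdIdem_stdGen_self (j : Fin ω.length) : stdIdem k ω j (stdGen k j) = stdGen k j := by
  rw [stdIdem_apply, stdGen, Pi.single_eq_same]

theorem stdIdem_stdGen_of_ne {j l : Fin ω.length} (h : j ≠ l) :
    stdIdem k ω j (stdGen k l) = 0 := by
  rw [stdIdem_apply, stdGen, Pi.single_eq_of_ne h, Pi.single_zero]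

theorem stdIdem_mul_self (j : Fin ω.length) : stdIdem k ω j * stdIdem k ω j = stdIdem k ω j :=
  LinearMap.ext fun m => by
    rw [Module.End.mul_apply, stdIdem_apply, stdIdem_apply, Pi.single_eq_same]

theorem sum_stdIdem : ∑ j, stdIdem k ω j = 1 :=
  LinearMap.ext fun m => by
    rw [LinearMap.sum_apply]
    exact Finset.univ_sum_single m

end Summands

/-! ### Heredity ideals in general rings. -/

section HeredityIdeals

variable {A B : Type*} [Ring A] [Ring B]

theorem subset_idealGen (S : Set A) : S ⊆ idealGen S := fun x hx => by
  have := Submodule.smul_mem_smul (Ideal.subset_span hx) (Submodule.mem_top : (1 : A) ∈ (⊤ : Ideal A))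
  simpa [idealGen] using this

theorem idealGen_le {S : Set A} {I : Ideal A} [I.IsTwoSided] (h : S ⊆ I) : idealGen S ≤ I :=
  (Ideal.mul_mono_left (Ideal.span_le.2 h)).trans Ideal.mul_le_left

theorem idealGen_mono {S T : Set A} (h : S ⊆ T) : idealGen S ≤ idealGen T :=
  idealGen_le (h.trans (subset_idealGen T))

theorem idealGen_empty : idealGen (∅ : Set A) = ⊥ :=
  le_bot_iff.1 (idealGen_le (Set.empty_subset _))

theorem map_idealGen {f : A →+* B} (hf : Function.Surjective f) (S : Set A) :
    (idealGen S).map f = idealGen (f '' S) := by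
  have : RingHomSurjective f := ⟨hf⟩
  apply le_antisymm
  · rw [Ideal.map_le_iff_le_comap]
    exact idealGen_le fun x hx => subset_idealGen _ ⟨x, hx, rfl⟩
  · refine idealGen_le ?_
    rintro _ ⟨x, hx, rfl⟩
    exact Ideal.mem_map_of_mem f (subset_idealGen S hx)

/-- An isomorphism of rings restricts to a semilinear isomorphism between an ideal and its
image. -/
noncomputable def idealMapEquiv (σ : A ≃+* B) (I : Ideal A) :
    letI := RingHomInvPair.of_ringEquiv σ
    letI := RingHomInvPair.symm (σ : A →+* B) (σ.symm : B →+* A)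
    I ≃ₛₗ[(σ : A →+* B)] I.map σ :=
  letI := RingHomInvPair.of_ringEquiv σ
  letI := RingHomInvPair.symm (σ : A →+* B) (σ.symm : B →+* A)
  { toFun := fun x => ⟨σ x, Ideal.mem_map_of_mem σ x.2⟩
    map_add' := fun x y => Subtype.ext (map_add σ _ _)
    map_smul' := fun r x => Subtype.ext (map_mul σ _ _)
    invFun := fun y => ⟨σ.symm y, by
      obtain ⟨x, hx, h⟩ := (Ideal.mem_map_of_equiv σ (y : B)).1 y.2
      rwa [← h, RingEquiv.symm_apply_apply]⟩
    left_inv := fun x => Subtype.ext (σ.symm_apply_apply _)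
    right_inv := fun y => Subtype.ext (σ.apply_symm_apply _) }

theorem IsHeredityIdeal.map_equiv {I : Ideal A} (h : IsHeredityIdeal I) (σ : A ≃+* B) :
    IsHeredityIdeal (I.map σ) := by
  let _ := RingHomInvPair.of_ringEquiv σ
  let _ := RingHomInvPair.symm (σ : A →+* B) (σ.symm : B →+* A)
  have : RingHomSurjective (σ : A →+* B) := ⟨σ.surjective⟩
  have := h.isTwoSided
  have := h.projective
  have := h.semisimple_end
  refine ⟨inferInstanceAs (I.map (σ : A →+* B)).IsTwoSided, ?_, ?_, ?_⟩
  · apply le_antisymm Ideal.mul_le_right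
    rw [Ideal.map_le_iff_le_comap]
    conv_lhs => rw [← h.mul_self]
    refine Ideal.mul_le.2 fun r hr s hs => ?_
    rw [Ideal.mem_comap, map_mul]
    exact Submodule.smul_mem_smul (Ideal.mem_map_of_mem σ hr) (Ideal.mem_map_of_mem σ hs)
  · exact Module.Projective.of_equiv (idealMapEquiv σ I)
  · exact (idealMapEquiv σ I).conjRingEquiv.isSemisimpleRing

/-- The heredity property of `J / I` can be checked after any surjection with kernel `I`. -/
theorem IsHeredityIdeal.of_surjective {I J : Ideal A} [I.IsTwoSided] (ψ : A →+* B)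
    (hψ : Function.Surjective ψ) (hI : RingHom.ker ψ = I) (h : IsHeredityIdeal (J.map ψ)) :
    IsHeredityIdeal (J.map (Ideal.Quotient.mk I)) := by
  have h0 : ∀ a ∈ I, ψ a = 0 := fun a ha => by rwa [← RingHom.mem_ker, hI]
  let σ : A ⧸ I ≃+* B := RingEquiv.ofBijective (Ideal.Quotient.lift I ψ h0)
    ⟨RingHom.lift_injective_of_ker_le_ideal I h0 hI.le,
      Ideal.Quotient.lift_surjective_of_surjective I h0 hψ⟩
  have h1 : J.map (Ideal.Quotient.mk I) = (J.map ψ).map σ.symm := by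
    have : (σ.symm : B →+* A ⧸ I).comp ψ = Ideal.Quotient.mk I :=
      RingHom.ext fun a => σ.symm_apply_eq.2 rfl
    rw [← this]
    exact (Ideal.map_map ψ (σ.symm : B →+* A ⧸ I)).symm
  rw [h1]
  exact h.map_equiv σ.symm

/-- The isomorphism `A / I ≃ B` given by a surjection `A → B` with kernel `I`. -/
noncomputable def quotientAlgEquivOfSurjective {k : Type*} [CommSemiring k] [Algebra k A]
    [Algebra k B] (f : A →ₐ[k] B) (hf : Function.Surjective f) (I : Ideal A) [I.IsTwoSided]
    (hI : RingHom.ker f = I) : (A ⧸ I) ≃ₐ[k] B :=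
  have h0 : ∀ a, a ∈ I → f a = 0 := fun a ha => by rwa [← RingHom.mem_ker, hI]
  AlgEquiv.ofBijective (Ideal.Quotient.liftₐ I f h0)
    ⟨RingHom.lift_injective_of_ker_le_ideal (f := (f : A →+* B)) I h0 hI.le,
      Ideal.Quotient.lift_surjective_of_surjective (f := (f : A →+* B)) I h0 hf⟩

/-- If `e A e` consists of scalars and `A e A` is a direct sum of finitely many copies of `A e`,
then `A e A` is a heredity ideal. -/
theorem isHeredityIdeal_of_basis (k : Type*) [Field k] [Algebra k A] {e : A} (he : e * e = e)
    (hk : ∀ a, ∃ c : k, e * a * e = c • e) {ι : Type*} [Fintype ι] [DecidableEq ι] (x : ι → A)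
    (hx : ∀ b, e * x b = x b) (hspan : ∀ a ∈ idealGen {e}, ∃ c : ι → A, a = ∑ b, c b * x b)
    (hindep : ∀ c : ι → A, ∑ b, c b * x b = 0 → ∀ b, c b * e = 0) :
    IsHeredityIdeal (idealGen {e}) := by
  have hmem : e ∈ idealGen {e} := subset_idealGen _ (Set.mem_singleton e)
  have hae : ∀ a : Ideal.span {e}, (a : A) * e = a := fun a => by
    obtain ⟨b, hb⟩ := Ideal.mem_span_singleton'.1 a.2
    rw [← hb, mul_assoc, he]
  have hxI : ∀ b, x b ∈ idealGen {e} := fun b => hx b ▸ Ideal.mul_mem_right _ _ hmem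
  let F : (ι → Ideal.span {e}) →ₗ[A] idealGen {e} :=
    { toFun := fun c => ⟨∑ b, (c b : A) * x b,
        Ideal.sum_mem _ fun b _ => Ideal.mul_mem_left _ _ (hxI b)⟩
      map_add' := fun c d => Subtype.ext (by simp [add_mul, Finset.sum_add_distrib])
      map_smul' := fun r c => Subtype.ext (by simp [Finset.mul_sum, mul_assoc]) }
  have hF : Function.Bijective F := by
    constructor
    · rw [← LinearMap.ker_eq_bot, LinearMap.ker_eq_bot']
      intro c hc
      funext b
      have := hindep (fun b => c b) (congrArg Subtype.val hc) b
      rw [hae] at this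
      exact Subtype.ext this
    · rintro ⟨a, ha⟩
      obtain ⟨c, rfl⟩ := hspan a ha
      refine ⟨fun b => ⟨c b * e, Ideal.mem_span_singleton'.2 ⟨c b, rfl⟩⟩, Subtype.ext ?_⟩
      exact Finset.sum_congr rfl fun b _ => by rw [mul_assoc, hx]
  let σ := LinearEquiv.ofBijective F hF
  have hproj : Module.Projective A (Ideal.span {e}) := by
    refine Module.Projective.of_split (Submodule.subtype _)
      (LinearMap.codRestrict (Ideal.span {e}) (LinearMap.toSpanSingleton A A e)
        fun a => Ideal.mem_span_singleton'.2 ⟨a, rfl⟩) ?_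
    exact LinearMap.ext fun a => Subtype.ext (hae a)
  -- An endomorphism of `A e` is determined by the image of `e`, which lies in `e A e` and so is a
  -- scalar multiple of `e`.
  have hss : IsSemisimpleRing (Module.End A (Ideal.span {e})) := by
    refine RingHom.isSemisimpleRing_of_surjective
      (algebraMap k (Module.End A (Ideal.span {e}))) fun f => ?_
    let g : Ideal.span {e} := ⟨e, Ideal.mem_span_singleton_self e⟩
    obtain ⟨b, hb⟩ := Ideal.mem_span_singleton'.1 (f g).2
    obtain ⟨c, hc⟩ := hk b
    refine ⟨c, LinearMap.ext fun a => ?_⟩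
    have ha : a = (a : A) • g := Subtype.ext (hae a).symm
    have hg : g = e • g := Subtype.ext he.symm
    have hfg : f g = c • g := by
      rw [hg, map_smul]
      refine Subtype.ext ?_
      rw [← hg]
      change e * (f g : A) = c • e
      rw [← hb, ← hc, mul_assoc]
    rw [ha, map_smul, map_smul, hfg, Module.algebraMap_end_apply]
  refine ⟨inferInstance, ?_, ?_, ?_⟩
  · refine le_antisymm Ideal.mul_le_right (idealGen_le ?_)
    rw [Set.singleton_subset_iff]
    have : e * e ∈ idealGen {e} * idealGen {e} := Submodule.smul_mem_smul hmem hmem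
    rwa [he] at this
  · have : Module.Projective A (ι → Ideal.span {e}) :=
      .of_equiv' (DFinsupp.linearEquivFunOnFintype (R := A) (M := fun _ : ι => Ideal.span {e}))
    exact .of_equiv' σ
  -- As `A e A` is a finite power of `A e`, its endomorphism ring is a matrix ring over the
  -- semisimple ring `End (A e)`.
  · exact (endVecRingEquivMatrixEnd ι A (Ideal.span {e})).symm.trans σ.conjRingEquiv
      |>.isSemisimpleRing

end HeredityIdeals

/-! ### Removing the first letter of the word. -/

section FirstLayer

variable (k : Type*) [Field k] {V : Type*} [Fintype V] [Quiver V] [∀ i j : V, Fintype (i ⟶ j)]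

theorem outArr_mem_vertexIdeal [hl : ∀ i : V, IsEmpty (i ⟶ i)] {h i : V} (a : QEdge h i) :
    outArr k a ∈ vertexIdeal k i := by
  have h1 : (1 - vertexIdem k i) * outArr k a = outArr k a := by
    rw [← vertexIdem_mul_outArr, ← mul_assoc, sub_mul,
      vertexIdem_mul_of_ne k (ne_of_qEdge a).symm, one_mul, sub_zero]
  rw [← h1]
  exact Ideal.mul_mem_right _ _ (one_sub_vertexIdem_mem k i)

theorem vertexIdem_mem_vertexIdeal {i j : V} (h : i ≠ j) : vertexIdem k j ∈ vertexIdeal k i := by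
  have h1 : (1 - vertexIdem k i) * vertexIdem k j = vertexIdem k j := by
    rw [sub_mul, vertexIdem_mul_of_ne k h, one_mul, sub_zero]
  rw [← h1]
  exact Ideal.mul_mem_right _ _ (one_sub_vertexIdem_mem k i)

theorem vertexIdeal_mul_top (i : V) : vertexIdeal k i * ⊤ = vertexIdeal k i :=
  le_antisymm Ideal.mul_le_left fun x hx => by
    have : x * 1 ∈ vertexIdeal k i * ⊤ := Submodule.smul_mem_smul hx Submodule.mem_top
    rwa [mul_one] at this

theorem exists_eq_sum_smul_stdGen {ω : List V} (m : StdObj k ω) :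
    ∃ x : Fin ω.length → Preproj k V, m = ∑ j, x j • stdGen k j := by
  choose x hx using fun j => StdSummand.exists_smul_proj_one k (m j)
  refine ⟨x, ?_⟩
  conv_lhs => rw [← Finset.univ_sum_single m]
  exact Finset.sum_congr rfl fun j _ => by rw [stdGen, ← Pi.single_smul, ← hx]

variable {i : V} {ω : List V}

theorem wordIdeal_take_cons_le (j : Fin (i :: ω).length) :
    wordIdeal k ((i :: ω).take (j + 1)) ≤ vertexIdeal k i :=
  Ideal.mul_le_left

theorem smul_stdGen_zero {x : Preproj k V} (hx : x ∈ vertexIdeal k i) :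
    x • stdGen k (0 : Fin (i :: ω).length) = 0 :=
  smul_stdGen_eq_zero k ((vertexIdeal_mul_top k i).symm ▸ hx :)

theorem exists_stdSummandQuot (j : Fin ω.length) :
    ∃ f : StdSummand k (i :: ω) j.succ →ₗ[Preproj k V] StdSummand k ω j,
      f (StdSummand.proj k (i :: ω) j.succ 1) = StdSummand.proj k ω j 1 := by
  refine StdSummand.exists_lift k _ fun x hx => ?_
  rw [← map_smul, smul_eq_mul, mul_one, StdSummand.proj_eq_zero_iff]
  exact Ideal.mul_le_right (I := vertexIdeal k i) hx

variable (i ω) in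
/-- The canonical surjection from `M` for the word `s_i w` onto `M` for the word `w`. -/
noncomputable def stdQuot : StdObj k (i :: ω) →ₗ[Preproj k V] StdObj k ω :=
  LinearMap.pi fun j => (exists_stdSummandQuot k j).choose ∘ₗ LinearMap.proj j.succ

theorem stdQuot_apply {m : StdObj k (i :: ω)} {j : Fin ω.length} {x : Preproj k V}
    (hx : m j.succ = x • StdSummand.proj k (i :: ω) j.succ 1) :
    stdQuot k i ω m j = x • StdSummand.proj k ω j 1 := by
  have := (exists_stdSummandQuot k (i := i) j).choose_spec
  change (exists_stdSummandQuot k (i := i) j).choose (m j.succ) = _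
  rw [hx, map_smul, this]

theorem stdQuot_stdGen_succ (j : Fin ω.length) :
    stdQuot k i ω (stdGen k (ω := i :: ω) j.succ) = stdGen k j := by
  funext l
  by_cases h : l = j
  · subst h
    rw [stdQuot_apply k (x := 1) (by rw [one_smul, stdGen, Pi.single_eq_same]), one_smul, stdGen,
      Pi.single_eq_same]
  · rw [stdQuot_apply k (x := 0) (by
      rw [zero_smul, stdGen, Pi.single_eq_of_ne fun h' => h (Fin.succ_injective _ h')]), zero_smul,
      stdGen, Pi.single_eq_of_ne h]

theorem stdQuot_eq_zero_of_succ {m : StdObj k (i :: ω)} (h : ∀ j : Fin ω.length, m j.succ = 0) :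
    stdQuot k i ω m = 0 := by
  funext l
  rw [stdQuot_apply k (x := 0) (by rw [zero_smul, h]), zero_smul, Pi.zero_apply]

theorem stdQuot_stdGen_zero : stdQuot k i ω (stdGen k (0 : Fin (i :: ω).length)) = 0 :=
  stdQuot_eq_zero_of_succ k fun j => by rw [stdGen, Pi.single_eq_of_ne (Fin.succ_ne_zero j)]

theorem stdQuot_surjective : Function.Surjective (stdQuot k i ω) := by
  intro m
  obtain ⟨x, rfl⟩ := exists_eq_sum_smul_stdGen k m
  refine ⟨∑ j, x j • stdGen k (ω := i :: ω) j.succ, ?_⟩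
  rw [map_sum]
  exact Finset.sum_congr rfl fun j _ => by rw [map_smul, stdQuot_stdGen_succ]

/-- The relations of the summands for `i :: ω` are `I_i` times those for `ω`, so `I_i` annihilates
what the quotient map kills; `M_1` is annihilated by `I_i` as well. -/
theorem smul_eq_zero_of_stdQuot {m : StdObj k (i :: ω)} (hm : stdQuot k i ω m = 0)
    {r : Preproj k V} (hr : r ∈ vertexIdeal k i) : r • m = 0 := by
  funext j
  obtain ⟨x, hx⟩ := StdSummand.exists_smul_proj_one k (m j)
  rw [Pi.smul_apply, hx, Pi.zero_apply, smul_smul, ← map_smul, smul_eq_mul, mul_one,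
    StdSummand.proj_eq_zero_iff]
  induction j using Fin.cases with
  | zero =>
    change _ ∈ vertexIdeal k i * ⊤
    rw [vertexIdeal_mul_top]
    exact Ideal.mul_mem_right _ _ (Ideal.mul_mem_right _ _ hr)
  | succ j =>
    have h := stdQuot_apply k hx
    rw [hm, Pi.zero_apply, ← map_smul, smul_eq_mul, mul_one] at h
    rw [mul_assoc]
    exact Submodule.smul_mem_smul hr ((StdSummand.proj_eq_zero_iff k).1 h.symm)

/-- Modulo `I_i` every element of `Λ` acts on the generator as a scalar, since `1 - e_i` and the
arrows into `i` lie in `I_i`. -/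
theorem exists_smul_proj_zero [hl : ∀ i : V, IsEmpty (i ⟶ i)]
    (m : StdSummand k (i :: ω) 0) :
    ∃ c : k, m = c • StdSummand.proj k (i :: ω) 0 1 := by
  obtain ⟨x, rfl⟩ := StdSummand.proj_surjective k (i :: ω) 0 m
  obtain ⟨c, y, hcy⟩ := exists_vertexIdem_mul_eq k i x
  refine ⟨c, ?_⟩
  rw [← algebraMap_smul (Preproj k V) c, ← map_smul, ← sub_eq_zero, ← map_sub,
    StdSummand.proj_eq_zero_iff]
  change _ ∈ vertexIdeal k i * ⊤
  rw [vertexIdeal_mul_top]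
  have : (x - algebraMap k (Preproj k V) c • 1) * vertexIdem k i =
      (1 - vertexIdem k i) * x * vertexIdem k i + inMap k i y * vertexIdem k i := by
    have h2 : inMap k i y = vertexIdem k i * x - c • vertexIdem k i := by rw [hcy]; abel
    rw [h2, algebraMap_smul]
    simp only [sub_mul, smul_mul_assoc, one_mul, vertexIdem_mul_self]
    abel
  refine this ▸ Ideal.add_mem _ ?_ ?_
  · exact Ideal.mul_mem_right _ _ (Ideal.mul_mem_right _ _ (one_sub_vertexIdem_mem k i))
  · exact Ideal.mul_mem_right _ _ (inMap_mem k fun h a =>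
      Ideal.mul_mem_right _ _ (inArr_mem_vertexIdeal k a))

open Classical in
/-- The character of `Λ` given by the simple module at `i`. -/
theorem exists_character (i : V) :
    ∃ χ : Preproj k V →ₐ[k] k, χ (vertexIdem k i) = 1 := by
  let f : DoubleGen V → k := fun g => match g with
    | .vertex j => if j = i then 1 else 0
    | .arrow _ => 0
    | .star _ => 0
  have hf : ∀ ⦃x y⦄, PreprojRel k x y → FreeAlgebra.lift k f x = FreeAlgebra.lift k f y := by
    intro x y h
    cases h with
    | idem j => simp [f]
    | orth j l h =>
      have : ¬ (j = i ∧ l = i) := fun h' => h (h'.1.trans h'.2.symm)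
      by_cases hj : j = i <;> by_cases hl : l = i <;> simp_all [f]
    | sum_one => simp [f]
    | arrow a => simp [f]
    | star a => simp [f]
    | preproj => simp [f]
  exact ⟨preprojLift k f hf, (preprojLift_mk k f hf _).trans (by simp [f])⟩

theorem vertexIdem_not_mem (i : V) : vertexIdem k i ∉ vertexIdeal k i := by
  obtain ⟨χ, hχ⟩ := exists_character k i
  intro h
  have hle : vertexIdeal k i ≤ RingHom.ker χ := by
    refine idealGen_le ?_
    rw [Set.singleton_subset_iff]
    change χ (1 - vertexIdem k i) = 0
    rw [map_sub, hχ, map_one, sub_self]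
  have : χ (vertexIdem k i) = 0 := hle h
  rw [hχ] at this
  exact one_ne_zero this

theorem isSimpleModule_stdSummand_zero [hl : ∀ i : V, IsEmpty (i ⟶ i)] :
    IsSimpleModule (WordAlg k (i :: ω)) (StdSummand k (i :: ω) 0) := by
  have hne : StdSummand.proj k (i :: ω) 0 1 ≠ 0 := by
    intro h
    rw [StdSummand.proj_eq_zero_iff, one_mul] at h
    exact vertexIdem_not_mem k i (wordIdeal_take_cons_le k _ h)
  rw [isSimpleModule_iff_toSpanSingleton_surjective]
  refine ⟨⟨_, _, hne⟩, fun m hm n => ?_⟩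
  obtain ⟨c, rfl⟩ := exists_smul_proj_zero k m
  obtain ⟨d, rfl⟩ := exists_smul_proj_zero k n
  have hc : c ≠ 0 := by
    rintro rfl
    exact hm (zero_smul _ _)
  refine ⟨algebraMap k _ (d * c⁻¹), ?_⟩
  rw [LinearMap.toSpanSingleton_apply, algebraMap_smul, smul_smul, mul_assoc, inv_mul_cancel₀ hc,
    mul_one]

variable [DecidableEq V] [hl : ∀ i : V, IsEmpty (i ⟶ i)]

/-- The kernel of `stdQuot` is the largest submodule which is a sum of copies of the simple module
at `i`. -/
theorem stdQuot_eq_zero_iff (h : IsReducedWord (i :: ω)) {m : StdObj k (i :: ω)} :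
    stdQuot k i ω m = 0 ↔ ∀ r ∈ vertexIdeal k i, r • m = 0 := by
  refine ⟨fun hm r hr => smul_eq_zero_of_stdQuot k hm hr, fun hm => ?_⟩
  funext j
  obtain ⟨x, hx⟩ := StdSummand.exists_smul_proj_one k (m j.succ)
  rw [stdQuot_apply k hx, Pi.zero_apply, ← map_smul, smul_eq_mul, mul_one,
    StdSummand.proj_eq_zero_iff]
  -- Prefixes of reduced words are reduced, so socle-freeness at `i` is available for the ideal
  -- defining each summand separately.
  have hr : IsReducedWord (i :: ω.take (j + 1)) := CoxeterSystem.IsReduced.take h (j + 2)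
  have hfree := socleFree_wordIdeal k hr
  set y := x * vertexIdem k ω[j] with hy
  have hmul : ∀ r ∈ vertexIdeal k i, r * y ∈ wordIdeal k (ω.take (j + 1)) := by
    intro r hr
    have := congrFun (hm r hr) j.succ
    rw [Pi.smul_apply, hx, Pi.zero_apply, smul_smul, ← map_smul, smul_eq_mul, mul_one,
      StdSummand.proj_eq_zero_iff, mul_assoc] at this
    exact Ideal.mul_le_right (I := vertexIdeal k i) this
  have h1 := hfree y fun g a => hmul _ (outArr_mem_vertexIdeal k a)
  have h2 := hmul _ (one_sub_vertexIdem_mem k i)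
  have : y = vertexIdem k i * y + (1 - vertexIdem k i) * y := by noncomm_ring
  rw [this]
  exact Ideal.add_mem _ h1 h2

/-- Being annihilated by `I_i` is preserved by every `Λ`-linear map; reducedness enters through the
description of the kernel. -/
theorem stdQuot_map_eq_zero (h : IsReducedWord (i :: ω)) (f : StdEnd k (i :: ω))
    {m : StdObj k (i :: ω)} (hm : stdQuot k i ω m = 0) : stdQuot k i ω (f m) = 0 := by
  rw [stdQuot_eq_zero_iff k h] at hm ⊢
  intro r hr
  rw [← stdEnd_map_smul, hm r hr, map_zero]

theorem exists_stdEnd_descend (h : IsReducedWord (i :: ω)) (f : StdEnd k (i :: ω)) :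
    ∃ g : StdEnd k ω, ∀ m, g (stdQuot k i ω m) = stdQuot k i ω (f m) := by
  obtain ⟨g, hg⟩ := exists_stdEnd k
    (fun j : Fin ω.length => stdQuot k i ω (f (stdGen k (ω := i :: ω) j.succ))) (by
      intro j x hx
      rw [← map_smul, ← stdEnd_map_smul]
      apply stdQuot_map_eq_zero k h
      rw [map_smul, stdQuot_stdGen_succ, ← vertexIdem_smul_stdGen, smul_smul]
      exact smul_stdGen_eq_zero k hx)
  refine ⟨g, fun m => ?_⟩
  obtain ⟨x, rfl⟩ := exists_eq_sum_smul_stdGen k m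
  simp only [map_sum, map_smul, stdEnd_map_smul]
  refine Finset.sum_congr rfl fun j _ => congrArg (x j • ·) ?_
  induction j using Fin.cases with
  | zero => rw [stdQuot_stdGen_zero, map_zero, stdQuot_map_eq_zero k h f (stdQuot_stdGen_zero k)]
  | succ j => rw [stdQuot_stdGen_succ, hg]

/-- Endomorphisms of `M` for the word `s_i w` induce endomorphisms of `M` for the word `w`. -/
theorem exists_stdEnd_algHom (h : IsReducedWord (i :: ω)) :
    ∃ φ : StdEnd k (i :: ω) →ₐ[k] StdEnd k ω, ∀ f m,
      φ f (stdQuot k i ω m) = stdQuot k i ω (f m) := by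
  choose φ hφ using exists_stdEnd_descend k h
  have huniq : ∀ {g g' : StdEnd k ω},
      (∀ m, g (stdQuot k i ω m) = g' (stdQuot k i ω m)) → g = g' := fun hg =>
    LinearMap.ext fun m => by
      obtain ⟨m, rfl⟩ := stdQuot_surjective k (i := i) m
      exact hg m
  refine ⟨{ toFun := φ, map_one' := ?_, map_mul' := ?_, map_zero' := ?_, map_add' := ?_,
            commutes' := ?_ }, hφ⟩
  · exact huniq fun m => hφ 1 m
  · intro f g
    exact huniq fun m => by
      rw [hφ, Module.End.mul_apply, Module.End.mul_apply, hφ, hφ]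
  · exact huniq fun m => by
      rw [hφ, LinearMap.zero_apply, LinearMap.zero_apply, map_zero]
  · intro f g
    exact huniq fun m => by
      rw [hφ, LinearMap.add_apply, LinearMap.add_apply, map_add, hφ, hφ]
  · intro c
    exact huniq fun m => by
      rw [hφ, Module.algebraMap_end_apply, Module.algebraMap_end_apply, ← stdObj_smul_algebraMap,
        map_smul, stdObj_smul_algebraMap]

/-- The algebra homomorphism `Γ_{s_i w} → Γ_w` for a reduced expression. -/
noncomputable def stdEndQuot (h : IsReducedWord (i :: ω)) : StdEnd k (i :: ω) →ₐ[k] StdEnd k ω :=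
  (exists_stdEnd_algHom k h).choose

theorem stdEndQuot_apply (h : IsReducedWord (i :: ω)) (f : StdEnd k (i :: ω))
    (m : StdObj k (i :: ω)) :
    stdEndQuot k h f (stdQuot k i ω m) = stdQuot k i ω (f m) :=
  (exists_stdEnd_algHom k h).choose_spec f m

/-- Any lifts of the images of the generators satisfy the relations upstairs: those are `I_i` times
the relations downstairs, which send the lifts into the kernel of `stdQuot`, where `I_i` acts as
zero. The generator of `M_1` may be sent to `0`. -/
theorem stdEndQuot_surjective (h : IsReducedWord (i :: ω)) :
    Function.Surjective (stdEndQuot k h) := by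
  intro g
  choose m hm using fun j : Fin ω.length => stdQuot_surjective k (i := i) (g (stdGen k j))
  obtain ⟨n, hn0, hn⟩ : ∃ n : Fin (i :: ω).length → StdObj k (i :: ω), n (0 : Fin (_ + 1)) = 0 ∧
      ∀ j : Fin ω.length, n j.succ = vertexIdem k ω[j] • m j :=
    ⟨Fin.cases (n := ω.length) 0 fun j => vertexIdem k ω[j] • m j, rfl, fun _ => rfl⟩
  obtain ⟨f, hf⟩ := exists_stdEnd k (ω := i :: ω) n (by
      intro j x hx
      induction j using Fin.cases with
      | zero => exact (congrArg (x • ·) hn0).trans (smul_zero x)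
      | succ j =>
        rw [hn, smul_smul]
        refine Submodule.smul_induction_on
          (I := vertexIdeal k i) (N := wordIdeal k (ω.take (j + 1)))
          (p := fun z => z • m j = 0) hx ?_ ?_
        · intro r hr y hy
          rw [smul_eq_mul, mul_smul]
          refine smul_eq_zero_of_stdQuot k ?_ hr
          rw [map_smul, hm, ← stdEnd_map_smul, smul_stdGen_eq_zero k hy, map_zero]
        · intro x y hx hy
          rw [add_smul, hx, hy, add_zero])
  refine ⟨f, stdEnd_ext k fun j => ?_⟩
  rw [← stdQuot_stdGen_succ k (i := i), stdEndQuot_apply, hf, hn,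
    map_smul, hm, ← stdEnd_map_smul, vertexIdem_smul_stdGen, stdQuot_stdGen_succ]

theorem stdEndQuot_stdIdem_zero (h : IsReducedWord (i :: ω)) :
    stdEndQuot k h (stdIdem k (i :: ω) (0 : Fin (ω.length + 1))) = 0 := by
  refine stdEnd_ext k fun j => ?_
  rw [← stdQuot_stdGen_succ k (i := i), stdEndQuot_apply,
    stdIdem_stdGen_of_ne k (Fin.succ_ne_zero j).symm, map_zero, LinearMap.zero_apply]

theorem stdEndQuot_stdIdem_succ (h : IsReducedWord (i :: ω)) (j : Fin ω.length) :
    stdEndQuot k h (stdIdem k (i :: ω) j.succ) = stdIdem k ω j := by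
  refine stdEnd_ext k fun l => ?_
  rw [← stdQuot_stdGen_succ k (i := i), stdEndQuot_apply, stdQuot_stdGen_succ]
  by_cases hl : j = l
  · subst hl
    rw [stdIdem_stdGen_self, stdIdem_stdGen_self, stdQuot_stdGen_succ]
  · rw [stdIdem_stdGen_of_ne k hl,
      stdIdem_stdGen_of_ne k fun h' => hl (Fin.succ_injective _ h'), map_zero]

end FirstLayer

/-! ### Finite dimensionality. -/

section Finiteness

variable (k : Type*) [Field k] {V : Type*} [Fintype V] [Quiver V] [∀ i j : V, Fintype (i ⟶ j)]

/-- The ideals `I_w` have finite codimension. -/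
theorem exists_fg_complement_wordIdeal [hl : ∀ i : V, IsEmpty (i ⟶ i)] (ω : List V) :
    ∃ F : Submodule k (Preproj k V), F.FG ∧ ∀ x, ∃ f ∈ F, x - f ∈ wordIdeal k ω := by
  induction ω with
  | nil => exact ⟨⊥, Submodule.fg_bot, fun x => ⟨0, Submodule.zero_mem _, Submodule.mem_top⟩⟩
  | cons i ω ih =>
    obtain ⟨F, hF, hx⟩ := ih
    choose f hf hxf using hx
    refine ⟨(F.map (LinearMap.mulLeft k (1 - vertexIdem k i)) ⊔
      Submodule.span k {vertexIdem k i}) ⊔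
      ⨆ h, ⨆ a : QEdge h i, F.map (LinearMap.mulLeft k (inArr k a)),
      ((hF.map _).sup (Submodule.fg_span_singleton _)).sup
        (Submodule.fg_iSup _ fun h => Submodule.fg_iSup _ fun a => hF.map _), fun x => ?_⟩
    -- Write `x = (1 - e_i) x + c e_i + ∑ a y_a` over arrows `a` into `i`, and approximate `x` in
    -- the first term and each `y_a` modulo `I_ω`. The errors acquire a left factor in `I_i`.
    obtain ⟨c, y, hcy⟩ := exists_vertexIdem_mul_eq k i x
    refine ⟨((1 - vertexIdem k i) * f x + c • vertexIdem k i) + inMap k i fun h a => f (y h a),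
      Submodule.add_mem_sup (Submodule.add_mem_sup ⟨_, hf _, rfl⟩
        (Submodule.mem_span_singleton.2 ⟨c, rfl⟩)) ?_, ?_⟩
    · refine Submodule.sum_mem _ fun h _ => Submodule.sum_mem _ fun a _ => ?_
      exact Submodule.mem_iSup_of_mem h (Submodule.mem_iSup_of_mem a ⟨_, hf _, rfl⟩)
    · have : x - (((1 - vertexIdem k i) * f x + c • vertexIdem k i) +
          inMap k i fun h a => f (y h a)) =
          (1 - vertexIdem k i) * (x - f x) + inMap k i fun h a => y h a - f (y h a) := by
        have h1 : x = (1 - vertexIdem k i) * x + (c • vertexIdem k i + inMap k i y) := by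
          rw [← hcy]; noncomm_ring
        have h2 : (inMap k i fun h a => y h a - f (y h a)) =
            inMap k i y - inMap k i fun h a => f (y h a) :=
          map_sub (inMap k i) y fun h a => f (y h a)
        rw [h2, mul_sub]
        nth_rewrite 1 [h1]
        abel
      rw [this]
      refine Ideal.add_mem _ (Submodule.smul_mem_smul (one_sub_vertexIdem_mem k i) (hxf x)) ?_
      exact inMap_mem k fun h a => Submodule.smul_mem_smul (inArr_mem_vertexIdeal k a) (hxf _)

theorem finite_stdSummand [hl : ∀ i : V, IsEmpty (i ⟶ i)] (ω : List V) (j : Fin ω.length) :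
    Module.Finite k (StdSummand k ω j) := by
  obtain ⟨F, hF, hx⟩ := exists_fg_complement_wordIdeal k (ω.take (j + 1))
  have h : F.map ((StdSummand.proj k ω j).restrictScalars k) = ⊤ := by
    refine eq_top_iff.2 fun m _ => ?_
    obtain ⟨x, rfl⟩ := StdSummand.proj_surjective k ω j m
    obtain ⟨f, hf, hxf⟩ := hx x
    refine ⟨f, hf, ?_⟩
    rw [LinearMap.restrictScalars_apply, eq_comm, ← sub_eq_zero, ← map_sub,
      StdSummand.proj_eq_zero_iff]
    exact Ideal.mul_mem_right _ _ hxf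
  exact ⟨h ▸ hF.map _⟩

theorem finite_stdEnd [hl : ∀ i : V, IsEmpty (i ⟶ i)] (ω : List V) :
    Module.Finite k (StdEnd k ω) := by
  have := finite_stdSummand k ω
  let F : StdEnd k ω →ₗ[k] Module.End k (StdObj k ω) :=
    { toFun := fun f => f.restrictScalars k
      map_add' := fun _ _ => rfl
      map_smul' := fun _ _ => rfl }
  exact Module.Finite.of_injective F (LinearMap.restrictScalars_injective k)

end Finiteness

/-! ### The ideal `Γ ε_1 Γ` and the heredity chain. -/

section HeredityChain

variable (k : Type*) [Field k] {V : Type*} [Fintype V] [Quiver V] [∀ i j : V, Fintype (i ⟶ j)]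

theorem stdChain_zero (ω : List V) : stdChain k ω 0 = ⊥ := by
  rw [stdChain, ← idealGen_empty]
  congr 1
  ext x
  simp

theorem stdChain_length (ω : List V) : stdChain k ω ω.length = ⊤ := by
  rw [Ideal.eq_top_iff_one, ← sum_stdIdem]
  exact Ideal.sum_mem _ fun j _ => subset_idealGen _ ⟨j, j.2, rfl⟩

theorem stdChain_le_succ (ω : List V) (m : ℕ) : stdChain k ω m ≤ stdChain k ω (m + 1) :=
  idealGen_mono fun _ ⟨j, hj, hx⟩ => ⟨j, hj.trans m.lt_succ_self, hx⟩

variable {i : V} {ω : List V}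

theorem stdChain_cons_one :
    stdChain k (i :: ω) 1 = idealGen {stdIdem k (i :: ω) (0 : Fin (ω.length + 1))} := by
  rw [stdChain]
  congr 1
  ext x
  constructor
  · rintro ⟨j, hj, rfl⟩
    have : j = (0 : Fin (ω.length + 1)) := Fin.ext (Nat.lt_one_iff.1 hj)
    rw [this]
    rfl
  · rintro rfl
    exact ⟨(0 : Fin (ω.length + 1)), zero_lt_one, rfl⟩

theorem exists_stdIdem_mul_mul_stdIdem [hl : ∀ i : V, IsEmpty (i ⟶ i)]
    (a : StdEnd k (i :: ω)) :
    ∃ c : k, stdIdem k (i :: ω) (0 : Fin (ω.length + 1)) * a *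
      stdIdem k (i :: ω) (0 : Fin (ω.length + 1)) =
        c • stdIdem k (i :: ω) (0 : Fin (ω.length + 1)) := by
  obtain ⟨c, hc⟩ := exists_smul_proj_zero k
    (a (stdGen k (0 : Fin (i :: ω).length)) (0 : Fin (i :: ω).length))
  refine ⟨c, stdEnd_ext k fun l => ?_⟩
  rw [Module.End.mul_apply, LinearMap.smul_apply]
  by_cases hl : (0 : Fin (ω.length + 1)) = l
  · subst hl
    rw [stdIdem_stdGen_self, Module.End.mul_apply, stdIdem_apply]
    refine (congrArg (Pi.single _) hc).trans ?_
    rw [Pi.single_smul]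
    rfl
  · rw [stdIdem_stdGen_of_ne k hl, map_zero, smul_zero]

/-- The endomorphisms factoring the canonical surjections from the summands `M_j` with `i_j = i`
onto the first summand. -/
theorem exists_toFirst (b : {j : Fin (i :: ω).length // (i :: ω)[j] = i}) :
    ∃ f : StdEnd k (i :: ω), ∀ l, f (stdGen k l) =
      if l = b then stdGen k (0 : Fin (i :: ω).length) else 0 := by
  refine exists_stdEnd k _ fun l x hx => ?_
  split_ifs with hl
  · subst hl
    rw [b.2] at hx
    have h0 : vertexIdem k i • stdGen k (0 : Fin (i :: ω).length) =
        stdGen k (0 : Fin (i :: ω).length) := vertexIdem_smul_stdGen k (0 : Fin (i :: ω).length)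
    refine Eq.trans ?_ (smul_stdGen_zero k (wordIdeal_take_cons_le k _ hx))
    rw [mul_smul, h0]
  · exact smul_zero x

/-- A choice of the endomorphisms of `exists_toFirst`. -/
noncomputable def toFirst (b : {j : Fin (i :: ω).length // (i :: ω)[j] = i}) :
    StdEnd k (i :: ω) :=
  (exists_toFirst k b).choose

theorem toFirst_stdGen (b : {j : Fin (i :: ω).length // (i :: ω)[j] = i})
    (l : Fin (i :: ω).length) :
    toFirst k b (stdGen k l) = if l = b then stdGen k (0 : Fin (i :: ω).length) else 0 :=
  (exists_toFirst k b).choose_spec l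

theorem stdIdem_mul_toFirst (b : {j : Fin (i :: ω).length // (i :: ω)[j] = i}) :
    stdIdem k (i :: ω) (0 : Fin (ω.length + 1)) * toFirst k b = toFirst k b := by
  refine stdEnd_ext k fun l => ?_
  rw [Module.End.mul_apply, toFirst_stdGen]
  split_ifs
  · exact stdIdem_stdGen_self k _
  · exact map_zero _

variable [DecidableEq V]

theorem eq_zero_of_sum_mul_toFirst
    (c : {j : Fin (i :: ω).length // (i :: ω)[j] = i} → StdEnd k (i :: ω))
    (hc : ∑ b, c b * toFirst k b = 0) (b : {j : Fin (i :: ω).length // (i :: ω)[j] = i}) :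
    c b * stdIdem k (i :: ω) (0 : Fin (ω.length + 1)) = 0 := by
  have h := congrArg (fun f : StdEnd k (i :: ω) => f (stdGen k (b : Fin (i :: ω).length))) hc
  rw [LinearMap.sum_apply, Finset.sum_eq_single b] at h
  · rw [Module.End.mul_apply, toFirst_stdGen, if_pos rfl, LinearMap.zero_apply] at h
    refine stdEnd_ext k fun l => ?_
    rw [Module.End.mul_apply, LinearMap.zero_apply]
    by_cases hl : (0 : Fin (ω.length + 1)) = l
    · subst hl
      exact (congrArg (c b) (stdIdem_stdGen_self k _)).trans h
    · exact (congrArg (c b) (stdIdem_stdGen_of_ne k hl)).trans (map_zero _)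
  · intro d _ hd
    rw [Module.End.mul_apply, toFirst_stdGen, if_neg fun h' => hd (Subtype.ext h'.symm), map_zero]
  · simp

/-- The values of `f` are annihilated by `I_i`. So `f` kills the generators at vertices other than
`i`, whose idempotents lie in `I_i`, while each remaining value is also the image of the generator
of `M_1` under some endomorphism. -/
theorem exists_eq_sum_mul_toFirst {f : StdEnd k (i :: ω)}
    (hf : ∀ m, stdQuot k i ω (f m) = 0) :
    ∃ c : {j : Fin (i :: ω).length // (i :: ω)[j] = i} → StdEnd k (i :: ω),
      f = ∑ b, c b * toFirst k b := by
  have hex : ∀ b : {j : Fin (i :: ω).length // (i :: ω)[j] = i}, ∃ g : StdEnd k (i :: ω),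
      ∀ l, g (stdGen k l) = if l = (0 : Fin (ω.length + 1)) then f (stdGen k b) else 0 := by
    intro b
    refine exists_stdEnd k _ fun l x hx => ?_
    split_ifs with hl
    · subst hl
      have h0 : vertexIdem k i • f (stdGen k (b : Fin (i :: ω).length)) =
          f (stdGen k (b : Fin (i :: ω).length)) := by
        rw [← stdEnd_map_smul]
        congr 1
        have := vertexIdem_smul_stdGen k (b : Fin (i :: ω).length)
        rwa [b.2] at this
      have hx' : x * vertexIdem k i ∈ vertexIdeal k i := wordIdeal_take_cons_le k _ hx
      rw [← h0, smul_smul]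
      exact smul_eq_zero_of_stdQuot k (hf _) hx'
    · exact smul_zero x
  choose c hc using hex
  refine ⟨c, stdEnd_ext k fun l => ?_⟩
  rw [LinearMap.sum_apply]
  by_cases hl : (i :: ω)[l] = i
  · rw [Finset.sum_eq_single ⟨l, hl⟩]
    · rw [Module.End.mul_apply, toFirst_stdGen, if_pos rfl]
      exact ((hc ⟨l, hl⟩ _).trans (if_pos rfl)).symm
    · intro d _ hd
      rw [Module.End.mul_apply, toFirst_stdGen, if_neg fun h' => hd (Subtype.ext h'.symm), map_zero]
    · simp
  · rw [Finset.sum_eq_zero]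
    · rw [← vertexIdem_smul_stdGen, stdEnd_map_smul]
      exact smul_eq_zero_of_stdQuot k (hf _) (vertexIdem_mem_vertexIdeal k (Ne.symm hl))
    · intro d _
      rw [Module.End.mul_apply, toFirst_stdGen, if_neg fun h' => hl (by rw [h']; exact d.2), map_zero]

variable [hl : ∀ i : V, IsEmpty (i ⟶ i)]

theorem stdQuot_eq_zero_of_mem_ker (h : IsReducedWord (i :: ω)) {f : StdEnd k (i :: ω)}
    (hf : f ∈ RingHom.ker (stdEndQuot k h)) (m : StdObj k (i :: ω)) :
    stdQuot k i ω (f m) = 0 := by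
  rw [← stdEndQuot_apply k h, (RingHom.mem_ker.1 hf :), LinearMap.zero_apply]

theorem ker_stdEndQuot (h : IsReducedWord (i :: ω)) :
    RingHom.ker (stdEndQuot k h) =
      idealGen {stdIdem k (i :: ω) (0 : Fin (ω.length + 1))} := by
  classical
  apply le_antisymm
  · intro f hf
    obtain ⟨c, rfl⟩ := exists_eq_sum_mul_toFirst k (stdQuot_eq_zero_of_mem_ker k h hf)
    refine Ideal.sum_mem _ fun b _ => Ideal.mul_mem_left _ _ ?_
    rw [← stdIdem_mul_toFirst]
    exact Ideal.mul_mem_right _ _ (subset_idealGen _ rfl)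
  · refine idealGen_le ?_
    rw [Set.singleton_subset_iff]
    exact stdEndQuot_stdIdem_zero k h

theorem isHeredityIdeal_stdIdem_zero (h : IsReducedWord (i :: ω)) :
    IsHeredityIdeal (idealGen {stdIdem k (i :: ω) (0 : Fin (ω.length + 1))}) := by
  classical
  refine isHeredityIdeal_of_basis k (stdIdem_mul_self k _) (exists_stdIdem_mul_mul_stdIdem k)
    (toFirst k) (stdIdem_mul_toFirst k) (fun a ha => ?_) (eq_zero_of_sum_mul_toFirst k)
  rw [← ker_stdEndQuot k h] at ha
  exact exists_eq_sum_mul_toFirst k (stdQuot_eq_zero_of_mem_ker k h ha)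

/-- `Γ_{s_i w} / Γ ε_1 Γ` is isomorphic to `Γ_w`. -/
noncomputable def stdEndQuotEquiv (h : IsReducedWord (i :: ω)) :
    (StdEnd k (i :: ω) ⧸ idealGen {stdIdem k (i :: ω) (0 : Fin (ω.length + 1))}) ≃ₐ[k]
      StdEnd k ω :=
  quotientAlgEquivOfSurjective (stdEndQuot k h) (stdEndQuot_surjective k h) _ (ker_stdEndQuot k h)

theorem stdEndQuotEquiv_mk (h : IsReducedWord (i :: ω)) (j : Fin ω.length) :
    stdEndQuotEquiv k h (Ideal.Quotient.mk _ (stdIdem k (i :: ω) j.succ)) = stdIdem k ω j :=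
  stdEndQuot_stdIdem_succ k h j

theorem map_stdChain_succ (h : IsReducedWord (i :: ω)) (m : ℕ) :
    (stdChain k (i :: ω) (m + 1)).map (stdEndQuot k h : StdEnd k (i :: ω) →+* StdEnd k ω) =
      stdChain k ω m := by
  rw [stdChain, map_idealGen (f := (stdEndQuot k h : StdEnd k (i :: ω) →+* StdEnd k ω))
    (stdEndQuot_surjective k h)]
  apply le_antisymm
  · refine idealGen_le ?_
    rintro _ ⟨_, ⟨j, hj, rfl⟩, rfl⟩
    induction j using Fin.cases with
    | zero =>
      have : stdEndQuot k h (stdIdem k (i :: ω) (0 : Fin (ω.length + 1))) ∈ stdChain k ω m := by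
        rw [stdEndQuot_stdIdem_zero]
        exact Ideal.zero_mem _
      exact this
    | succ j =>
      refine subset_idealGen _ ⟨j, ?_, stdEndQuot_stdIdem_succ k h j⟩
      simpa using hj
  · refine idealGen_mono ?_
    rintro _ ⟨j, hj, rfl⟩
    exact ⟨_, ⟨j.succ, by simpa using hj, rfl⟩, stdEndQuot_stdIdem_succ k h j⟩

theorem isHeredityChain_stdChain (ω : List V) (hω : IsReducedWord ω) :
    IsHeredityChain (stdChain k ω) ω.length := by
  refine ⟨stdChain_zero k ω, stdChain_length k ω, fun m _ => stdChain_le_succ k ω m, ?_⟩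
  induction ω with
  | nil => exact fun m hm => absurd hm m.not_lt_zero
  | cons i ω ih =>
    intro m hm
    cases m with
    | zero =>
      -- The bottom ideal is zero, so the identity replaces the quotient map and the first layer is
      -- `Γ ε_1 Γ` itself.
      refine IsHeredityIdeal.of_surjective (RingHom.id _) Function.surjective_id ?_ ?_
      · rw [stdChain_zero]
        exact RingHom.ker_coe_equiv (RingEquiv.refl (StdEnd k (i :: ω)))
      · rw [Ideal.map_id, zero_add, stdChain_cons_one]
        exact isHeredityIdeal_stdIdem_zero k hω
    | succ m =>
      have h := ih (isReducedWord_cons_iff.1 hω).1 m (Nat.lt_of_succ_lt_succ hm)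
      -- Each higher layer is transported from the shorter word: the ideal generated by `m + 1`
      -- idempotents is the preimage of the one generated by `m` idempotents there, since it
      -- contains the kernel `Γ ε_1 Γ`.
      refine IsHeredityIdeal.of_surjective ((Ideal.Quotient.mk (stdChain k ω m)).comp
        (stdEndQuot k hω : StdEnd k (i :: ω) →+* StdEnd k ω))
        (Ideal.Quotient.mk_surjective.comp (stdEndQuot_surjective k hω)) ?_ ?_
      · have hk : RingHom.ker (stdEndQuot k hω) ≤ stdChain k (i :: ω) (m + 1) := by
          rw [ker_stdEndQuot, ← stdChain_cons_one]
          exact idealGen_mono fun _ ⟨j, hj, hx⟩ => ⟨j, by omega, hx⟩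
        apply le_antisymm
        · intro x hx
          have hx' : stdEndQuot k hω x ∈ stdChain k ω m := Ideal.Quotient.eq_zero_iff_mem.1 hx
          rw [← map_stdChain_succ k hω] at hx'
          obtain ⟨y, hy, hyx⟩ := (Ideal.mem_map_iff_of_surjective
            (stdEndQuot k hω : StdEnd k (i :: ω) →+* StdEnd k ω)
            (stdEndQuot_surjective k hω)).1 hx'
          have : x - y ∈ stdChain k (i :: ω) (m + 1) := hk (by
            rw [RingHom.mem_ker, map_sub, sub_eq_zero]
            exact hyx.symm)
          exact (Submodule.sub_mem_iff_left _ hy).1 this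
        · intro x hx
          refine Ideal.Quotient.eq_zero_iff_mem.2 ?_
          rw [← map_stdChain_succ k hω]
          exact Ideal.mem_map_of_mem _ hx
      · rw [← Ideal.map_map, map_stdChain_succ]
        exact h

end HeredityChain

theorem NoOrientedCycles.isEmpty {V : Type*} [Quiver V] (hQ : NoOrientedCycles V) (i : V) :
    IsEmpty (i ⟶ i) :=
  ⟨fun a => one_ne_zero (hQ i a.toPath)⟩

theorem theorem2p1 (k : Type*) [Field k] {V : Type*} [Fintype V] [DecidableEq V] [Quiver V]
    [∀ i j : V, Fintype (i ⟶ j)] (hQ : NoOrientedCycles V) (ω : List V) (hω : IsReducedWord ω) :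
    IsQuasihereditary k (StdEnd k ω) ∧
    IsHeredityChain (stdChain k ω) ω.length ∧
    ∀ (i : V) (ω' : List V), ω = i :: ω' →
      IsSimpleModule (WordAlg k (i :: ω')) (StdSummand k (i :: ω') 0) ∧
      IsHeredityIdeal (idealGen {stdIdem k (i :: ω') 0}) ∧
      ∃ φ : (StdEnd k (i :: ω') ⧸ idealGen {stdIdem k (i :: ω') 0}) ≃ₐ[k] StdEnd k ω',
        ∀ j : Fin ω'.length,
          φ (Ideal.Quotient.mk _ (stdIdem k (i :: ω') j.succ)) = stdIdem k ω' j := by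
  have hl := hQ.isEmpty
  have hchain := isHeredityChain_stdChain k ω hω
  refine ⟨⟨finite_stdEnd k ω, ω.length, stdChain k ω, inferInstance, hchain⟩, hchain, ?_⟩
  rintro i ω' rfl
  exact ⟨isSimpleModule_stdSummand_zero k, isHeredityIdeal_stdIdem_zero k hω,
    stdEndQuotEquiv k hω, stdEndQuotEquiv_mk k hω⟩
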